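/- Let $n\ge 1$, $1<p<\infty$, $c_0>0$, $1/2<R\le 1$, and let $\omega:[0,\infty)\to\mathbb R$ satisfy $\omega(0)=0$ and $\omega(t)\to0$ as $t\to0^+$. Write $B_\rho(x)$ for the open Euclidean ball in $\mathbb R^n$ and $B_\rho=B_\rho(0)$. There is a constant $c_1>0$, depending only on $n,p,c_0,R$ and $\omega$, such that the following holds. Let $\varphi\in C^2(B_1)$ satisfy $|D^2\varphi(x)-D^2\varphi(y)|\le\omega(|x-y|)$ for all $x,y\in B_R$ (operator norm) and $$|\nabla\varphi|^{2-p}\,\mathrm{div}\bigl(|\nabla\varphi|^{p-2}\nabla\varphi\bigr)\le -c_0\qquad\text{in } B_1\cap\{\nabla\varphi\neq0\}.$$ Let $u$ be a continuous weak solution of the $p$-Laplacian obstacle problem $$\min\{-\Delta_p u,\;u-\varphi\}=0\quad\text{in } B_1,\qquad \Delta_p u=\mathrm{div}\bigl(|\nabla u|^{p-2}\nabla u\bigr),$$ that is, $u\in C(B_1)\cap W^{1,p}_{\rm loc}(B_1)$, $u\ge\varphi$ in $B_1$, $\int_{B_1}|\nabla u|^{p-2}\nabla u\cdot\nabla\zeta\ge0$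 for every $\zeta\in C_c^\infty(B_1)$ with $\zeta\ge0$, and $\int_{\{u>\varphi\}}|\nabla u|^{p-2}\nabla u\cdot\nabla\zeta=0$ for every $\zeta\in C_c^\infty(\{u>\varphi\})$, where $\{u>\varphi\}=\{x\in B_1: u(x)>\varphi(x)\}$. Then for every free boundary point $x_0\in\partial\{u>\varphi\}\cap B_{1/2}$, $$\sup_{B_r(x_0)}(u-\varphi)\ge c_1r^2\qquad\text{for all } r\in(0,1/2).$$ (For every $\varphi\in C^2(B_1)$ and every $R<1$ such an $\omega$ exists.) -/

import Mathlib

open MeasureTheory Set Filter Topology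
open scoped Gradient

noncomputable section

namespace PObstacle

/-- `ℝⁿ` with the Euclidean norm. -/
abbrev Eucl (n : ℕ) : Type := EuclideanSpace ℝ (Fin n)

variable {n : ℕ}

/-- The field `|v|^{p-2} v` entering the `p`-Laplacian; it vanishes at `v = 0` for every `p`. -/
def flux (p : ℝ) (v : Eucl n) : Eucl n := ‖v‖ ^ (p - 2) • v

/-- The classical divergence `∑ᵢ ∂ᵢ Vᵢ` of a vector field. -/
def divergence (V : Eucl n → Eucl n) (x : Eucl n) : ℝ :=
  ∑ i : Fin n, (fderiv ℝ V x (EuclideanSpace.single i 1)) i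

/-- The classical `p`-Laplacian `div (|∇φ|^{p-2} ∇φ)`; it is meant for `φ` of class `C²` near a
point with `∇φ ≠ 0`. -/
def pLaplacian (p : ℝ) (φ : Eucl n → ℝ) (x : Eucl n) : ℝ :=
  divergence (fun y => flux p (∇ φ y)) x

/-- The Hessian `D²φ(x)`, as a linear map; its norm is the operator norm. -/
def hessian (φ : Eucl n → ℝ) (x : Eucl n) : Eucl n →L[ℝ] Eucl n :=
  fderiv ℝ (∇ φ) x

/-- The concavity condition `|∇φ|^{2-p} div (|∇φ|^{p-2} ∇φ) ≤ -c₀` in `Ω ∩ {∇φ ≠ 0}`. -/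
def ConcavityCondition (p c₀ : ℝ) (Ω : Set (Eucl n)) (φ : Eucl n → ℝ) : Prop :=
  ∀ x ∈ Ω, ∇ φ x ≠ 0 → ‖∇ φ x‖ ^ (2 - p) * pLaplacian p φ x ≤ -c₀

/-- `ω` vanishes at `0` and is continuous there, from the right. -/
def IsModulusOfContinuity (ω : ℝ → ℝ) : Prop :=
  ω 0 = 0 ∧ ContinuousWithinAt ω (Ici 0) 0

/-- `D²φ` has modulus of continuity `ω` on `S`. -/
def HessianHasModulusOn (ω : ℝ → ℝ) (S : Set (Eucl n)) (φ : Eucl n → ℝ) : Prop :=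
  ∀ x ∈ S, ∀ y ∈ S, ‖hessian φ x - hessian φ y‖ ≤ ω (dist x y)

/-- `ζ ∈ C_c^∞(Ω)`. -/
def IsTestFunction (Ω : Set (Eucl n)) (ζ : Eucl n → ℝ) : Prop :=
  ContDiff ℝ ((⊤ : ℕ∞) : WithTop ℕ∞) ζ ∧ HasCompactSupport ζ ∧ tsupport ζ ⊆ Ω

/-- `f ∈ L^p_loc(Ω)`, for functions with values in a normed group. -/
def MemLpLoc {F : Type*} [NormedAddCommGroup F] (p : ℝ) (Ω : Set (Eucl n)) (f : Eucl n → F) :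
    Prop :=
  ∀ K : Set (Eucl n), IsCompact K → K ⊆ Ω → MemLp f (ENNReal.ofReal p) (volume.restrict K)

/-- `u ∈ W^{1,p}_loc(Ω)`, with weak gradient `G`. -/
def IsW1pLocWithGradient (p : ℝ) (Ω : Set (Eucl n)) (u : Eucl n → ℝ) (G : Eucl n → Eucl n) :
    Prop :=
  MemLpLoc p Ω u ∧ MemLpLoc p Ω G ∧
    ∀ ζ : Eucl n → ℝ, IsTestFunction Ω ζ →
      ∫ x in Ω, u x • ∇ ζ x = -∫ x in Ω, ζ x • G x

/-- `-Δ_p u ≥ 0` weakly in `Ω`, for a function `u` with weak gradient `G`. -/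
def IsWeaklyPSuperharmonic (p : ℝ) (Ω : Set (Eucl n)) (G : Eucl n → Eucl n) : Prop :=
  ∀ ζ : Eucl n → ℝ, IsTestFunction Ω ζ → (∀ x, 0 ≤ ζ x) →
    0 ≤ ∫ x in Ω, inner ℝ (flux p (G x)) (∇ ζ x)

/-- `-Δ_p u = 0` weakly in `Ω`, for a function `u` with weak gradient `G`. -/
def IsWeaklyPHarmonic (p : ℝ) (Ω : Set (Eucl n)) (G : Eucl n → Eucl n) : Prop :=
  ∀ ζ : Eucl n → ℝ, IsTestFunction Ω ζ →
    ∫ x in Ω, inner ℝ (flux p (G x)) (∇ ζ x) = 0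

/-- The noncontact set `{u > φ}` in `Ω`. -/
def noncontactSet (Ω : Set (Eucl n)) (φ u : Eucl n → ℝ) : Set (Eucl n) :=
  {x ∈ Ω | φ x < u x}

/-- Continuous weak solutions of `min {-Δ_p u, u - φ} = 0` in `Ω`: `u ∈ C(Ω) ∩ W^{1,p}_loc(Ω)`
satisfies `u ≥ φ` and `-Δ_p u ≥ 0` in `Ω`, and `-Δ_p u = 0` in `{u > φ}`. -/
def IsObstacleSolution (p : ℝ) (Ω : Set (Eucl n)) (φ u : Eucl n → ℝ) : Prop :=
  ContinuousOn u Ω ∧ (∀ x ∈ Ω, φ x ≤ u x) ∧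
    ∃ G : Eucl n → Eucl n, IsW1pLocWithGradient p Ω u G ∧
      IsWeaklyPSuperharmonic p Ω G ∧ IsWeaklyPHarmonic p (noncontactSet Ω φ u) G

end PObstacle

end

/-! For a linear map `A`, the quadratic form `normalizedForm p A v` is (tr A)|v|² + (p-2)⟨Av, v⟩.
Expanding the divergence turns the concavity hypothesis into `normalizedForm p (D²φ(x)) (∇φ(x)) ≤
-c₀ |∇φ(x)|²`, which says nothing where ∇φ = 0. The usual nondegeneracy argument compares u with ψ =
φ + a|x - x₁|², where x₁ is a noncontact point close to x₀, and this needs ψ to be p-superharmonic.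
The difficulty is that ∇ψ differs from ∇φ, and the form is controlled only at the gradient itself.

The key is a dichotomy on a small ball B of radius comparable to r.

If ∇φ ≢ 0 on B, the bound extends from ∇φ(x) to every q within c times the radius of it, with some ε
in place of c₀ (`exists_normalizedForm_le_near_gradient`). Suppose it failed at q. With A = D²φ(x),
the largest coefficient of the form in an eigenbasis of A is then almost nonnegative, while some
coefficient is at most a negative constant. This forces the corresponding eigenvalue to dominate all
the others and to be bounded away from 0. Moving from x along its eigenvector displaces the gradient
by about rAe, to a vector where the form is too large for a gradient of φ (`exists_escape`). So no
such q exists, and `isWeaklyPSuperharmonic_add_quadratic` makes ψ a weak supersolution. Comparison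
in {u > φ} ∩ B_ρ(x₁) then gives a point of the closed ball with u - φ ≥ aρ²
(`exists_quadratic_le_of_superharmonic`).

If ∇φ ≡ 0 on B, then φ is constant near x₀ and u attains its minimum there. The strong minimum
principle (`strong_minimum_principle`, by a Hopf barrier) gives u = φ near x₀, so x₀ is not a free
boundary point.

Both cases rest on `weak_comparison`. Its test functions are smooth functions of mollifications, so
no Sobolev chain rule or Poincaré inequality is needed. -/

noncomputable section

namespace PObstacle

variable {n : ℕ}

/-! ### Linear algebra of the normalized p-Laplace form -/

/-- The trace of a linear map, in the standard coordinates. -/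
def coordTrace (A : Eucl n →L[ℝ] Eucl n) : ℝ :=
  ∑ i : Fin n, (A (EuclideanSpace.single i 1)) i

/-- The quadratic form `(tr A) |v|² + (p - 2) ⟨A v, v⟩` of the normalized `p`-Laplacian. -/
def normalizedForm (p : ℝ) (A : Eucl n →L[ℝ] Eucl n) (v : Eucl n) : ℝ :=
  coordTrace A * ‖v‖ ^ 2 + (p - 2) * inner ℝ (A v) v

/-- If the extremal eigenvalue `(p - 2) l i` gives an almost positive value of the normalized
operator while some other one gives a negative value, then `l i` controls all eigenvalues. -/
lemma exists_eigenvalue_control (p : ℝ) (hp : 1 < p) (c₀ : ℝ) (hc₀ : 0 < c₀) (n : ℕ) :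
    ∃ ε > 0, ε ≤ c₀ / 2 ∧ ∃ κ > 0, ∀ (l : Fin n → ℝ) (i j : Fin n),
      (∀ k, (p - 2) * l k ≤ (p - 2) * l i) → -ε < ∑ k, l k + (p - 2) * l i →
      ∑ k, l k + (p - 2) * l j ≤ -c₀ → ∀ k, |l k| ≤ κ * |l i| := by
  set N : ℝ := n + |p - 2| + 1 with hN
  have hN1 : 1 ≤ N := by have := abs_nonneg (p - 2); have : (0:ℝ) ≤ n := n.cast_nonneg; linarith
  have hn0 : (0:ℝ) ≤ n := n.cast_nonneg
  -- In `κ`, the term `n / (p - 1)` serves the case p < 2 and `2 * N` the case p > 2. The choice of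
  -- ε makes `N * ε = c₀ / 2`, half of the gap at `j`.
  refine ⟨c₀ / (2 * N), by positivity, ?_, 2 * N + n / (p - 1) + 1, ?_, ?_⟩
  · apply div_le_div_of_nonneg_left hc₀.le (by norm_num); linarith
  · have : 0 ≤ n / (p - 1) := div_nonneg hn0 (by linarith)
    linarith
  intro l i j hmax htop hj
  have hp1 : 0 ≤ n / (p - 1) := div_nonneg hn0 (by linarith)
  have hε : c₀ / (2 * N) ≤ c₀ / 2 := by
    apply div_le_div_of_nonneg_left hc₀.le (by norm_num); linarith
  rcases lt_trichotomy p 2 with h2 | h2 | h2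
  -- For p < 2, `l i` is the smallest eigenvalue, so only the largest, `l m`, needs a bound. The
  -- inequality at `j` gives Σ l ≤ (2 - p) `l m`, while Σ l ≥ `l m` + (n - 1) `l i`. Subtracting
  -- leaves the factor p - 1 in front of `l m`.
  · have hmin : ∀ k, l i ≤ l k := fun k => by
      have := hmax k; nlinarith
    obtain ⟨m, -, hm⟩ := Finset.exists_max_image Finset.univ l ⟨i, Finset.mem_univ i⟩
    have hsum : l m - l i ≤ ∑ k, (l k - l i) :=
      Finset.single_le_sum (f := fun k => l k - l i) (fun k _ => sub_nonneg.2 (hmin k))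
        (Finset.mem_univ m)
    rw [Finset.sum_sub_distrib, Finset.sum_const, Finset.card_univ, Fintype.card_fin,
      nsmul_eq_mul] at hsum
    have hmj : l j ≤ l m := hm j (Finset.mem_univ j)
    have h3 : (2 - p) * l j ≤ (2 - p) * l m := by nlinarith
    have habs := neg_abs_le (l i)
    have hle := le_abs_self (l i)
    have hn1 : (1:ℝ) ≤ n := by
      have : 0 < n := i.pos
      exact_mod_cast this
    have h4 : (p - 1) * l m ≤ n * |l i| := by nlinarith [abs_nonneg (l i)]
    have h5 : l m ≤ n / (p - 1) * |l i| := by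
      rw [div_mul_eq_mul_div, le_div_iff₀ (by linarith)]; linarith
    intro k
    have hk1 := hm k (Finset.mem_univ k)
    have hk2 := hmin k
    rw [abs_le]
    have := abs_nonneg (l i)
    constructor <;> nlinarith
  -- For p = 2 every coefficient equals the trace, which cannot be both > -c₀/2 and ≤ -c₀.
  · subst h2; exfalso; linarith
  -- For p > 2, `l i` is the largest eigenvalue. The lower bound on its coefficient limits the total
  -- deficit Σ (`l i` - `l k`), so |`l k`| ≤ ε + N |`l i`|. Inserting this at `j` shows ε ≤ N |`l
  -- i`|, which absorbs the additive ε.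
  · have hle : ∀ k, l k ≤ l i := fun k => by
      have := hmax k; nlinarith
    have hn1 : (1:ℝ) ≤ n := by
      have : 0 < n := i.pos
      exact_mod_cast this
    have habs2 : |p - 2| = p - 2 := abs_of_pos (by linarith)
    have hbd : ∀ k, |l k| ≤ c₀ / (2 * N) + N * |l i| := by
      intro k
      have hsum : l i - l k ≤ ∑ k, (l i - l k) :=
        Finset.single_le_sum (f := fun k => l i - l k) (fun k _ => sub_nonneg.2 (hle k))
          (Finset.mem_univ k)
      rw [Finset.sum_sub_distrib, Finset.sum_const, Finset.card_univ, Fintype.card_fin,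
        nsmul_eq_mul] at hsum
      have hpos : 0 < c₀ / (2 * N) := by positivity
      have h1 := le_abs_self (l i)
      have h2 := abs_nonneg (l i)
      rw [abs_le]
      constructor
      · have : (n - 1 + (p - 2)) * l i ≤ N * |l i| := by
          calc (n - 1 + (p - 2)) * l i ≤ (n - 1 + (p - 2)) * |l i| := by
                apply mul_le_mul_of_nonneg_left h1; linarith
            _ ≤ N * |l i| := by
                apply mul_le_mul_of_nonneg_right _ h2; linarith
        linarith
      · have := hle k; nlinarith
    have hsumlow : -(n * (c₀ / (2 * N) + N * |l i|)) ≤ ∑ k, l k := by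
      calc -(n * (c₀ / (2 * N) + N * |l i|)) = ∑ k : Fin n, -(c₀ / (2 * N) + N * |l i|) := by
            simp only [Finset.sum_const, Finset.card_univ, Fintype.card_fin, nsmul_eq_mul]
            ring
        _ ≤ _ := Finset.sum_le_sum fun k _ => by have := (abs_le.1 (hbd k)).1; linarith
    have hjl : -((p - 2) * (c₀ / (2 * N) + N * |l i|)) ≤ (p - 2) * l j := by
      have := (abs_le.1 (hbd j)).1; nlinarith
    have hkey : c₀ ≤ (N - 1) * (c₀ / (2 * N) + N * |l i|) := by
      have : N - 1 = n + (p - 2) := by rw [hN, habs2]; ring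
      rw [this]; linarith
    have hNε : N * (c₀ / (2 * N)) = c₀ / 2 := by field_simp
    have h6 : c₀ / (2 * N) ≤ N * |l i| := by
      have h7 : 0 ≤ c₀ / (2 * N) := by positivity
      have h8 : c₀ / 2 ≤ N * (N * |l i|) := by
        have : 0 ≤ N * |l i| := by positivity
        nlinarith
      have : N * (c₀ / (2 * N)) ≤ N * (N * |l i|) := by linarith
      exact le_of_mul_le_mul_left this (by linarith)
    intro k
    have := hbd k
    have h9 : 0 ≤ (n / (p - 1) + 1) * |l i| := by positivity
    nlinarith

set_option maxHeartbeats 1000000 in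
-- Coordinates are taken in an eigenbasis, and `b k` is the k-th coefficient of the form plus c₀. A
-- shift by σ r `l i` along the best axis adds a positive term of order r² (`l i`)². The eigenvalue
-- control makes every |`b k`| at most K |`l i`|, so perturbations of size c r cost at most a small
-- multiple of the same quantity, with c independent of the eigenvalues.
lemma exists_coordinate_escape (p : ℝ) (hp : 1 < p) (c₀ : ℝ) (hc₀ : 0 < c₀) (n : ℕ) :
    ∃ ε > 0, ∃ c > 0, ∀ (l q v₀ : Fin n → ℝ) (r : ℝ), 0 < r → v₀ ≠ 0 →
      ∑ k, (∑ m, l m + (p - 2) * l k) * v₀ k ^ 2 ≤ -c₀ * ∑ k, v₀ k ^ 2 →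
      -ε * ∑ k, q k ^ 2 < ∑ k, (∑ m, l m + (p - 2) * l k) * q k ^ 2 →
      ∃ i : Fin n, ∃ σ : ℝ, |σ| = 1 ∧ ∀ w : Fin n → ℝ, ∑ k, w k ^ 2 ≤ (c * r) ^ 2 →
        -c₀ * ∑ k, (q k + (if k = i then σ * r * l i else 0) + w k) ^ 2 <
          ∑ k, (∑ m, l m + (p - 2) * l k) *
            (q k + (if k = i then σ * r * l i else 0) + w k) ^ 2 := by
  obtain ⟨ε, hε, hεc, κ, hκ, H⟩ := exists_eigenvalue_control p hp c₀ hc₀ n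
  set N : ℝ := n + |p - 2| with hN
  have hN0 : 0 ≤ N := by positivity
  set N₁ : ℝ := (N * κ + 1) / c₀ with hN₁
  have hN₁0 : 0 < N₁ := by positivity
  set K : ℝ := 2 * (N * κ + 1) with hK
  have hK0 : 0 < K := by positivity
  -- The factor 3 + N₁ collects the perturbation errors: 2 from |q + s|² ≤ 2|q|² + 2|s|², 1 from the
  -- other half of the Young splitting, and N₁ from the term quadratic in w. Together they use at
  -- most c₀/4 of the available c₀/2.
  set c : ℝ := min 1 (c₀ / (4 * K * (3 + N₁))) with hc
  have hcpos : 0 < c := by positivity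
  have hc1 : c ≤ 1 := min_le_left _ _
  have hc2 : K * c * (3 + N₁) ≤ c₀ / 4 := by
    have : c ≤ c₀ / (4 * K * (3 + N₁)) := min_le_right _ _
    rw [le_div_iff₀ (by positivity)] at this
    linarith
  refine ⟨ε, hε, c, hcpos, ?_⟩
  intro l q v₀ r hr hv₀ hgood hbad
  have hne : ∃ k₀, v₀ k₀ ≠ 0 := by
    by_contra! h; exact hv₀ (funext h)
  obtain ⟨k₀, hk₀⟩ := hne
  have huniv : (Finset.univ : Finset (Fin n)).Nonempty := ⟨k₀, Finset.mem_univ _⟩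
  obtain ⟨i, -, hi⟩ := Finset.exists_max_image Finset.univ (fun k => (p - 2) * l k) huniv
  obtain ⟨j, hj⟩ : ∃ j, ∑ m, l m + (p - 2) * l j ≤ -c₀ := by
    by_contra! h
    have : -c₀ * ∑ k, v₀ k ^ 2 < ∑ k, (∑ m, l m + (p - 2) * l k) * v₀ k ^ 2 := by
      rw [Finset.mul_sum]
      apply Finset.sum_lt_sum
      · intro k _; exact mul_le_mul_of_nonneg_right (h k).le (sq_nonneg _)
      · exact ⟨k₀, Finset.mem_univ _, mul_lt_mul_of_pos_right (h k₀) (by positivity)⟩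
    linarith
  have htop : -ε < ∑ m, l m + (p - 2) * l i := by
    by_contra! h
    have : ∑ k, (∑ m, l m + (p - 2) * l k) * q k ^ 2 ≤ -ε * ∑ k, q k ^ 2 := by
      rw [Finset.mul_sum]
      apply Finset.sum_le_sum
      intro k hk
      apply mul_le_mul_of_nonneg_right _ (sq_nonneg _)
      have := hi k hk
      linarith
    linarith
  have hctl := H l i j (fun k => hi k (Finset.mem_univ _)) htop hj
  have hβ : ∀ k, |∑ m, l m + (p - 2) * l k| ≤ N * κ * |l i| := by
    intro k
    calc |∑ m, l m + (p - 2) * l k| ≤ |∑ m, l m| + |(p - 2) * l k| := abs_add_le _ _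
      _ ≤ ∑ m, |l m| + |p - 2| * |l k| := by
          rw [abs_mul]; gcongr; exact Finset.abs_sum_le_sum_abs _ _
      _ ≤ ∑ m : Fin n, κ * |l i| + |p - 2| * (κ * |l i|) := by
          gcongr with m _
          · exact hctl m
          · exact hctl k
      _ = N * κ * |l i| := by simp [hN]; ring
  have hli0 : c₀ ≤ (N * κ + 1) * |l i| := by
    have h1 := (abs_le.1 (hβ j)).1
    have := abs_nonneg (l i)
    linarith
  have hli : 0 < |l i| := by
    by_contra! h
    have : (N * κ + 1) * |l i| ≤ 0 := mul_nonpos_of_nonneg_of_nonpos (by positivity) h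
    linarith
  have hb : ∀ k, |∑ m, l m + (p - 2) * l k + c₀| ≤ K * |l i| := by
    intro k
    calc _ ≤ |∑ m, l m + (p - 2) * l k| + |c₀| := abs_add_le _ _
      _ ≤ N * κ * |l i| + (N * κ + 1) * |l i| := by
          rw [abs_of_pos hc₀]; exact add_le_add (hβ k) hli0
      _ ≤ K * |l i| := by rw [hK]; linarith
  set b : Fin n → ℝ := fun k => ∑ m, l m + (p - 2) * l k + c₀ with hbdef
  -- The sign makes the cross term between q and the shift nonnegative.
  obtain ⟨σ, hσ1, hσ⟩ : ∃ σ : ℝ, |σ| = 1 ∧ 0 ≤ σ * l i * q i := by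
    rcases le_total 0 (l i * q i) with h | h
    · exact ⟨1, by simp, by linarith⟩
    · exact ⟨-1, by simp, by linarith⟩
  refine ⟨i, σ, hσ1, fun w hw => ?_⟩
  set s : Fin n → ℝ := fun k => if k = i then σ * r * l i else 0 with hs
  have hσ2 : σ ^ 2 = 1 := by rw [← sq_abs, hσ1]; norm_num
  set Y2 : ℝ := r ^ 2 * l i ^ 2 with hY2
  have hY2pos : 0 < Y2 := by
    have : 0 < l i ^ 2 := by rw [← sq_abs]; positivity
    positivity
  set Q2 : ℝ := ∑ k, q k ^ 2 with hQ2
  have hQ2n : 0 ≤ Q2 := Finset.sum_nonneg fun k _ => sq_nonneg _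
  have hs2 : ∑ k, s k ^ 2 = Y2 := by
    simp only [hs, ite_pow]
    simp [hY2]
    rw [mul_pow, mul_pow, hσ2]; ring
  have hbi : c₀ / 2 ≤ b i := by simp only [hbdef]; linarith
  have hmain : (c₀ / 2) * (Q2 + Y2) ≤ ∑ k, b k * (q k + s k) ^ 2 := by
    have e1 : ∑ k, b k * (q k + s k) ^ 2 =
        ∑ k, b k * q k ^ 2 + 2 * ∑ k, b k * q k * s k + ∑ k, b k * s k ^ 2 := by
      rw [Finset.mul_sum, ← Finset.sum_add_distrib, ← Finset.sum_add_distrib]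
      exact Finset.sum_congr rfl fun k _ => by ring
    have e2 : ∑ k, b k * q k * s k = b i * (r * (σ * l i * q i)) := by
      simp [hs]; ring
    have e3 : ∑ k, b k * s k ^ 2 = b i * Y2 := by
      have : ∀ k, b k * s k ^ 2 = b i * s k ^ 2 := by
        intro k; by_cases h : k = i
        · rw [h]
        · simp [hs, h]
      rw [Finset.sum_congr rfl fun k _ => this k, ← Finset.mul_sum, hs2]
    have e4 : ∑ k, b k * q k ^ 2 = ∑ k, (∑ m, l m + (p - 2) * l k) * q k ^ 2 + c₀ * Q2 := by
      rw [hQ2, Finset.mul_sum, ← Finset.sum_add_distrib]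
      exact Finset.sum_congr rfl fun k _ => by simp only [hbdef]; ring
    have e5 : 0 ≤ b i * (r * (σ * l i * q i)) := by
      have : 0 ≤ b i := by linarith
      positivity
    have e6 : c₀ / 2 * Y2 ≤ b i * Y2 := mul_le_mul_of_nonneg_right hbi hY2pos.le
    rw [e1, e2, e3, e4]
    nlinarith
  have hw' : ∑ k, (K * l i ^ 2 / c) * w k ^ 2 ≤ K * c * Y2 := by
    rw [← Finset.mul_sum]
    calc K * l i ^ 2 / c * ∑ k, w k ^ 2 ≤ K * l i ^ 2 / c * (c * r) ^ 2 := by gcongr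
      _ = K * c * Y2 := by rw [hY2]; field_simp
  -- This error carries only one power of |`l i`|. The second, needed to compare with r² (`l i`)²,
  -- comes from the lower bound 1 ≤ N₁ |`l i`|.
  have hw'' : ∑ k, (K * |l i|) * w k ^ 2 ≤ K * c * N₁ * Y2 := by
    rw [← Finset.mul_sum]
    calc K * |l i| * ∑ k, w k ^ 2 ≤ K * |l i| * (c * r) ^ 2 := by gcongr
      _ ≤ K * c * (|l i| * 1) * r ^ 2 := by
          have : K * |l i| * (c * r) ^ 2 = c * (K * c * (|l i| * 1) * r ^ 2) := by ring
          rw [this]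
          apply mul_le_of_le_one_left _ hc1; positivity
      _ ≤ K * c * (|l i| * (N₁ * |l i|)) * r ^ 2 := by
          gcongr
          rw [hN₁, div_mul_eq_mul_div, le_div_iff₀ hc₀]; linarith
      _ = K * c * N₁ * Y2 := by rw [hY2, ← sq_abs (l i)]; ring
  have hqs : ∑ k, (K * c) * (q k + s k) ^ 2 ≤ K * c * (2 * Q2 + 2 * Y2) := by
    rw [← Finset.mul_sum]
    gcongr
    rw [hQ2, ← hs2, Finset.mul_sum, Finset.mul_sum, ← Finset.sum_add_distrib]
    exact Finset.sum_le_sum fun k _ => by nlinarith [sq_nonneg (q k - s k)]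
  have hterm : ∀ k, b k * (q k + s k) ^ 2 - (K * c) * (q k + s k) ^ 2
      - (K * l i ^ 2 / c) * w k ^ 2 - (K * |l i|) * w k ^ 2 ≤ b k * (q k + s k + w k) ^ 2 := by
    intro k
    obtain ⟨h1, h2⟩ := abs_le.1 (hb k)
    have h3 : -(K * |l i|) * w k ^ 2 ≤ b k * w k ^ 2 :=
      mul_le_mul_of_nonneg_right (by linarith) (sq_nonneg _)
    have h4 : |2 * b k * (q k + s k) * w k| ≤
        K * (2 * |q k + s k| * (|l i| * |w k|)) := by
      rw [abs_mul, abs_mul, abs_mul, abs_two]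
      have := hb k
      calc 2 * |b k| * |q k + s k| * |w k| ≤ 2 * (K * |l i|) * |q k + s k| * |w k| := by gcongr
        _ = _ := by ring
    have h5 : 2 * |q k + s k| * (|l i| * |w k|) ≤
        c * (q k + s k) ^ 2 + (l i ^ 2 / c) * w k ^ 2 := by
      have h6 : 0 ≤ (c * |q k + s k| - |l i| * |w k|) ^ 2 / c := by positivity
      have h7 : (c * |q k + s k| - |l i| * |w k|) ^ 2 / c =
          c * |q k + s k| ^ 2 + (|l i| ^ 2 / c) * |w k| ^ 2
            - 2 * |q k + s k| * (|l i| * |w k|) := by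
        field_simp; ring
      rw [h7, sq_abs, sq_abs, sq_abs] at h6
      linarith
    have h8 := (abs_le.1 h4).1
    have h9 := mul_le_mul_of_nonneg_left h5 hK0.le
    have h10 : K * (c * (q k + s k) ^ 2 + (l i ^ 2 / c) * w k ^ 2) =
      (K * c) * (q k + s k) ^ 2 + (K * l i ^ 2 / c) * w k ^ 2 := by ring
    have h11 : b k * (q k + s k + w k) ^ 2 = b k * (q k + s k) ^ 2
      + 2 * b k * (q k + s k) * w k + b k * w k ^ 2 := by ring
    linarith
  have hsum := Finset.sum_le_sum fun k (_ : k ∈ Finset.univ) => hterm k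
  rw [Finset.sum_sub_distrib, Finset.sum_sub_distrib, Finset.sum_sub_distrib] at hsum
  have hfin : 0 < ∑ k, b k * (q k + s k + w k) ^ 2 := by
    have h12 : K * c * (2 * Q2 + 2 * Y2) + K * c * Y2 + K * c * N₁ * Y2
        ≤ (c₀ / 4) * (Q2 + Y2) := by
      calc _ ≤ K * c * (3 + N₁) * (Q2 + Y2) := by
            have : 0 ≤ K * c * (1 + N₁) * Q2 := by positivity
            linarith
        _ ≤ _ := by gcongr
    have : 0 < (c₀ / 4) * (Q2 + Y2) := by positivity
    linarith
  have hsplit : ∑ k, b k * (q k + s k + w k) ^ 2 =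
      ∑ k, (∑ m, l m + (p - 2) * l k) * (q k + s k + w k) ^ 2
        + c₀ * ∑ k, (q k + s k + w k) ^ 2 := by
    rw [Finset.mul_sum, ← Finset.sum_add_distrib]
    exact Finset.sum_congr rfl fun k _ => by simp only [hbdef]; ring
  linarith

/-- Basis independence allows the trace to be read off as the sum of the eigenvalues. -/
lemma coordTrace_eq_trace (A : Eucl n →L[ℝ] Eucl n) :
    coordTrace A = LinearMap.trace ℝ (Eucl n) A.toLinearMap := by
  rw [LinearMap.trace_eq_sum_inner A.toLinearMap (EuclideanSpace.basisFun (Fin n) ℝ)]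
  simp [coordTrace, EuclideanSpace.inner_single_left]

/-- If the normalized form of a symmetric `A` is negative at some vector but almost nonnegative at
`q`, then translating `q` by a multiple of an eigenvector of `A` makes it stably nonnegative. -/
lemma exists_escape (p : ℝ) (hp : 1 < p) (c₀ : ℝ) (hc₀ : 0 < c₀) (n : ℕ) :
    ∃ ε > 0, ∃ c > 0, ∀ (A : Eucl n →L[ℝ] Eucl n) (q v₀ : Eucl n) (r : ℝ),
      A.toLinearMap.IsSymmetric → 0 < r → v₀ ≠ 0 →
      normalizedForm p A v₀ ≤ -c₀ * ‖v₀‖ ^ 2 → -ε * ‖q‖ ^ 2 < normalizedForm p A q →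
      ∃ e : Eucl n, ‖e‖ = 1 ∧ ∀ w : Eucl n, ‖w‖ ≤ c * r →
        -c₀ * ‖q + r • A e + w‖ ^ 2 < normalizedForm p A (q + r • A e + w) := by
  obtain ⟨ε, hε, c, hc, H⟩ := exists_coordinate_escape p hp c₀ hc₀ n
  refine ⟨ε, hε, c, hc, fun A q v₀ r hA hr hv₀ hgood hbad => ?_⟩
  have hn : Module.finrank ℝ (Eucl n) = n := by simp
  set b := hA.eigenvectorBasis hn with hb
  set l := hA.eigenvalues hn with hl
  have htr : coordTrace A = ∑ k, l k := by
    rw [coordTrace_eq_trace, hA.trace_eq_sum_eigenvalues hn]; rfl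
  have hnorm : ∀ v : Eucl n, ‖v‖ ^ 2 = ∑ k, b.repr v k ^ 2 := by
    intro v
    rw [← b.repr.norm_map v, EuclideanSpace.norm_sq_eq]
    simp
  have hAr : ∀ (v : Eucl n) k, b.repr (A v) k = l k * b.repr v k := fun v k =>
    hA.eigenvectorBasis_apply_self_apply hn v k
  have hform : ∀ v : Eucl n, normalizedForm p A v =
      ∑ k, (∑ m, l m + (p - 2) * l k) * b.repr v k ^ 2 := by
    intro v
    have : inner ℝ (A v) v = ∑ k, l k * b.repr v k ^ 2 := by
      rw [← b.repr.inner_map_map, PiLp.inner_apply]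
      refine Finset.sum_congr rfl fun k _ => ?_
      rw [hAr]; simp; ring
    rw [normalizedForm, htr, hnorm, this, Finset.mul_sum, Finset.mul_sum,
      ← Finset.sum_add_distrib]
    exact Finset.sum_congr rfl fun k _ => by ring
  obtain ⟨i, σ, hσ, hw⟩ := H l (fun k => b.repr q k) (fun k => b.repr v₀ k) r hr
    (by
      intro h
      apply hv₀
      apply b.repr.injective
      ext k
      simpa using congrFun h k)
    (by rw [hform, hnorm] at hgood; exact hgood)
    (by rw [hform, hnorm] at hbad; exact hbad)
  -- Since `b i` is an eigenvector, r A(σ `b i`) is exactly the coordinate shift σ r `l i`.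
  refine ⟨σ • b i, by rw [norm_smul, b.norm_eq_one, Real.norm_eq_abs, hσ, mul_one], ?_⟩
  intro w hwc
  have hco : ∀ k, b.repr (q + r • A (σ • b i) + w) k =
      b.repr q k + (if k = i then σ * r * l i else 0) + b.repr w k := by
    intro k
    have : b.repr (r • A (σ • b i)) k = if k = i then σ * r * l i else 0 := by
      rw [map_smul, PiLp.smul_apply, hAr, map_smul, PiLp.smul_apply, b.repr_self]
      by_cases h : k = i
      · subst h; simp; ring
      · simp [h]
    rw [map_add, map_add, PiLp.add_apply, PiLp.add_apply, this]
  have := hw (fun k => b.repr w k) (by rw [← hnorm]; gcongr)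
  rw [hform, hnorm]
  simpa only [hco] using this

lemma abs_coordTrace_le (A : Eucl n →L[ℝ] Eucl n) : |coordTrace A| ≤ n * ‖A‖ := by
  calc |coordTrace A| ≤ ∑ i : Fin n, |(A (EuclideanSpace.single i 1)) i| :=
        Finset.abs_sum_le_sum_abs _ _
    _ ≤ ∑ i : Fin n, ‖A‖ := by
        refine Finset.sum_le_sum fun i _ => ?_
        calc |(A (EuclideanSpace.single i 1)) i| ≤ ‖A (EuclideanSpace.single i 1)‖ := by
              rw [← Real.norm_eq_abs]; exact PiLp.norm_apply_le _ i
          _ ≤ ‖A‖ * ‖(EuclideanSpace.single i 1 : Eucl n)‖ := A.le_opNorm _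
          _ = ‖A‖ := by simp
    _ = n * ‖A‖ := by simp

lemma coordTrace_add (A B : Eucl n →L[ℝ] Eucl n) :
    coordTrace (A + B) = coordTrace A + coordTrace B := by
  simp [coordTrace, Finset.sum_add_distrib]

lemma coordTrace_sub (A B : Eucl n →L[ℝ] Eucl n) :
    coordTrace (A - B) = coordTrace A - coordTrace B := by
  simp [coordTrace, Finset.sum_sub_distrib]

lemma coordTrace_smul_id (a : ℝ) :
    coordTrace (a • ContinuousLinearMap.id ℝ (Eucl n)) = a * n := by
  simp [coordTrace, mul_comm]

lemma normalizedForm_add_smul_id (p a : ℝ) (A : Eucl n →L[ℝ] Eucl n) (v : Eucl n) :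
    normalizedForm p (A + a • ContinuousLinearMap.id ℝ (Eucl n)) v =
      normalizedForm p A v + a * (n + p - 2) * ‖v‖ ^ 2 := by
  rw [normalizedForm, normalizedForm, coordTrace_add, coordTrace_smul_id]
  simp only [add_apply, smul_apply,
    ContinuousLinearMap.id_apply, inner_add_left, real_inner_smul_left,
    real_inner_self_eq_norm_sq]
  ring

lemma normalizedForm_smul (p t : ℝ) (A : Eucl n →L[ℝ] Eucl n) (v : Eucl n) :
    normalizedForm p A (t • v) = t ^ 2 * normalizedForm p A v := by
  simp only [normalizedForm, map_smul, norm_smul, real_inner_smul_left, real_inner_smul_right,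
    mul_pow, Real.norm_eq_abs, sq_abs]
  ring

/-- This is the cost of freezing the Hessian at one point. -/
lemma abs_normalizedForm_sub_le (p : ℝ) (A B : Eucl n →L[ℝ] Eucl n) (v : Eucl n) :
    |normalizedForm p A v - normalizedForm p B v| ≤ (n + |p - 2|) * ‖A - B‖ * ‖v‖ ^ 2 := by
  have h : normalizedForm p A v - normalizedForm p B v =
      coordTrace (A - B) * ‖v‖ ^ 2 + (p - 2) * inner ℝ ((A - B) v) v := by
    rw [normalizedForm, normalizedForm, coordTrace_sub, sub_apply,
      inner_sub_left]
    ring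
  rw [h]
  calc _ ≤ |coordTrace (A - B) * ‖v‖ ^ 2| + |(p - 2) * inner ℝ ((A - B) v) v| := abs_add_le _ _
    _ ≤ n * ‖A - B‖ * ‖v‖ ^ 2 + |p - 2| * (‖A - B‖ * ‖v‖ * ‖v‖) := by
        rw [abs_mul, abs_mul, abs_of_nonneg (sq_nonneg ‖v‖)]
        gcongr
        · exact abs_coordTrace_le _
        · exact (abs_real_inner_le_norm _ _).trans (by gcongr; exact (A - B).le_opNorm v)
    _ = _ := by ring

lemma sum_normalizedForm_single (p : ℝ) (A : Eucl n →L[ℝ] Eucl n) :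
    ∑ i : Fin n, normalizedForm p A (EuclideanSpace.single i 1) = (n + p - 2) * coordTrace A := by
  have : ∀ i : Fin n, normalizedForm p A (EuclideanSpace.single i 1) =
      coordTrace A + (p - 2) * (A (EuclideanSpace.single i 1)) i := by
    intro i
    simp [normalizedForm, EuclideanSpace.inner_single_right]
  rw [Finset.sum_congr rfl fun i _ => this i, Finset.sum_add_distrib, ← Finset.mul_sum,
    Finset.sum_const, Finset.card_univ, Fintype.card_fin, nsmul_eq_mul, ← coordTrace]
  ring

/-- Summing the form over an orthonormal basis gives (n + p - 2) tr A, and the factor is positive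
once n ≥ 1. -/
lemma coordTrace_nonpos_of_normalizedForm {p : ℝ} (hp : 1 < p) {A : Eucl n →L[ℝ] Eucl n}
    (h : ∀ v, normalizedForm p A v ≤ 0) : coordTrace A ≤ 0 := by
  rcases Nat.eq_zero_or_pos n with h0 | h0
  · subst h0; simp [coordTrace]
  · have h1 : (1:ℝ) ≤ n := by exact_mod_cast h0
    have h2 : (n + p - 2) * coordTrace A ≤ 0 := by
      rw [← sum_normalizedForm_single]
      exact Finset.sum_nonpos fun i _ => h _
    by_contra! h3
    have : 0 < (n + p - 2) * coordTrace A := mul_pos (by linarith) h3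
    linarith

/-! ### Gradient and Hessian of a C² function -/

section Smooth

variable {φ : Eucl n → ℝ} {U : Set (Eucl n)}

lemma gradient_eq_comp (φ : Eucl n → ℝ) :
    ∇ φ = fun x => (InnerProductSpace.toDual ℝ (Eucl n)).symm (fderiv ℝ φ x) := rfl

lemma contDiffOn_gradient (hU : IsOpen U) (h : ContDiffOn ℝ 2 φ U) : ContDiffOn ℝ 1 (∇ φ) U := by
  rw [gradient_eq_comp]
  exact (InnerProductSpace.toDual ℝ (Eucl n)).symm.contDiff.comp_contDiffOn
    (h.fderiv_of_isOpen hU (by norm_num))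

lemma hasFDerivAt_gradient (hU : IsOpen U) (h : ContDiffOn ℝ 2 φ U) {x : Eucl n} (hx : x ∈ U) :
    HasFDerivAt (∇ φ) (hessian φ x) x :=
  (((contDiffOn_gradient hU h).contDiffAt (hU.mem_nhds hx)).differentiableAt
    one_ne_zero).hasFDerivAt

lemma continuousOn_gradient (hU : IsOpen U) (h : ContDiffOn ℝ 2 φ U) : ContinuousOn (∇ φ) U :=
  (contDiffOn_gradient hU h).continuousOn

lemma inner_hessian (hU : IsOpen U) (h : ContDiffOn ℝ 2 φ U) {x : Eucl n} (hx : x ∈ U)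
    (v w : Eucl n) : inner ℝ (hessian φ x v) w = fderiv ℝ (fderiv ℝ φ) x v w := by
  have hd : DifferentiableAt ℝ (fderiv ℝ φ) x :=
    ((h.fderiv_of_isOpen hU (by norm_num : (1:WithTop ℕ∞) + 1 ≤ 2)).contDiffAt
      (hU.mem_nhds hx)).differentiableAt one_ne_zero
  have h1 : HasFDerivAt (∇ φ) ((InnerProductSpace.toDual ℝ
      (Eucl n)).symm.toContinuousLinearEquiv.toContinuousLinearMap.comp
        (fderiv ℝ (fderiv ℝ φ) x)) x := by
    rw [gradient_eq_comp]
    exact ((InnerProductSpace.toDual ℝ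
      (Eucl n)).symm.toContinuousLinearEquiv.toContinuousLinearMap.hasFDerivAt).comp x
        hd.hasFDerivAt
  rw [hessian, h1.fderiv]
  simp

lemma hessian_isSymmetric (hU : IsOpen U) (h : ContDiffOn ℝ 2 φ U) {x : Eucl n} (hx : x ∈ U) :
    (hessian φ x).toLinearMap.IsSymmetric := by
  intro v w
  have hs : IsSymmSndFDerivAt ℝ φ x :=
    (h.contDiffAt (hU.mem_nhds hx)).isSymmSndFDerivAt (by simp)
  show inner ℝ (hessian φ x v) w = inner ℝ v (hessian φ x w)
  rw [real_inner_comm _ v, inner_hessian hU h hx, inner_hessian hU h hx]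
  exact hs v w

end Smooth

/-! ### The regularized flux and its divergence -/

/-- The regularization `(|v|² + δ)^{(p-2)/2} v` of the flux. -/
def regFlux (p δ : ℝ) (v : Eucl n) : Eucl n := (‖v‖ ^ 2 + δ) ^ ((p - 2) / 2) • v

lemma regFlux_zero (p : ℝ) (v : Eucl n) : regFlux p 0 v = flux p v := by
  rw [regFlux, flux, add_zero, ← Real.rpow_natCast_mul (norm_nonneg v)]
  congr 2
  push_cast; ring

lemma norm_regFlux_le {p δ : ℝ} (hδ : 0 ≤ δ) (v : Eucl n) :
    ‖regFlux p δ v‖ ≤ (‖v‖ ^ 2 + δ) ^ ((p - 1) / 2) := by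
  have hs : 0 ≤ ‖v‖ ^ 2 + δ := by positivity
  rcases hs.eq_or_lt with h | h
  · have hv : v = 0 := by
      have : ‖v‖ ^ 2 ≤ 0 := by linarith
      have : ‖v‖ = 0 := by nlinarith [norm_nonneg v]
      simpa using this
    subst hv
    simp only [regFlux, smul_zero, norm_zero]
    positivity
  · rw [regFlux, norm_smul, Real.norm_eq_abs, abs_of_nonneg (by positivity)]
    have h1 : ‖v‖ ≤ (‖v‖ ^ 2 + δ) ^ (1 / 2 : ℝ) := by
      rw [← Real.sqrt_eq_rpow]
      apply Real.le_sqrt_of_sq_le; linarith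
    calc (‖v‖ ^ 2 + δ) ^ ((p - 2) / 2) * ‖v‖
        ≤ (‖v‖ ^ 2 + δ) ^ ((p - 2) / 2) * (‖v‖ ^ 2 + δ) ^ (1 / 2 : ℝ) := by gcongr
      _ = (‖v‖ ^ 2 + δ) ^ ((p - 1) / 2) := by
        rw [← Real.rpow_add h]; congr 1; ring

lemma hasFDerivAt_regFlux_comp {p δ : ℝ} {W : Eucl n → Eucl n} {D : Eucl n →L[ℝ] Eucl n}
    {x : Eucl n} (hW : HasFDerivAt W D x) (hs : ‖W x‖ ^ 2 + δ ≠ 0) :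
    HasFDerivAt (fun y => regFlux p δ (W y))
      ((‖W x‖ ^ 2 + δ) ^ ((p - 2) / 2) • D +
        ((((p - 2) / 2) * (‖W x‖ ^ 2 + δ) ^ ((p - 2) / 2 - 1)) •
          ((2 : ℝ) • (innerSL ℝ (W x)).comp D)).smulRight (W x)) x := by
  have h1 : HasFDerivAt (fun y => ‖W y‖ ^ 2 + δ) ((2 : ℝ) • (innerSL ℝ (W x)).comp D) x := by
    rw [two_smul, ← two_nsmul]
    exact (hW.norm_sq).add_const δ
  exact (h1.rpow_const (Or.inl hs)).smul hW

/-- Factoring out the lowest power of |W|² + δ leaves a bracket that decides the sign. The case δ =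
0 is the p-Laplacian away from critical points. For δ > 0 the formula also holds at critical points,
at the price of the extra term δ tr D. -/
lemma divergence_regFlux {p δ : ℝ} {W : Eucl n → Eucl n} {D : Eucl n →L[ℝ] Eucl n}
    {x : Eucl n} (hW : HasFDerivAt W D x) (hs : 0 < ‖W x‖ ^ 2 + δ) :
    divergence (fun y => regFlux p δ (W y)) x =
      (‖W x‖ ^ 2 + δ) ^ ((p - 2) / 2 - 1) * (normalizedForm p D (W x) + δ * coordTrace D) := by
  rw [divergence, (hasFDerivAt_regFlux_comp hW hs.ne').fderiv]
  set s := ‖W x‖ ^ 2 + δ with hsdef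
  have hpow : s ^ ((p - 2) / 2) = s ^ ((p - 2) / 2 - 1) * s := by
    conv_rhs => rw [← Real.rpow_one s, ← Real.rpow_mul hs.le, one_mul, ← Real.rpow_add hs]
    ring_nf
  have hDW : ∑ i : Fin n, inner ℝ (W x) (D (EuclideanSpace.single i 1)) * (W x) i =
      inner ℝ (D (W x)) (W x) := by
    conv_rhs => rw [real_inner_comm, ← (EuclideanSpace.basisFun (Fin n) ℝ).sum_repr (W x)]
    rw [map_sum, inner_sum]
    simp only [EuclideanSpace.basisFun_repr, EuclideanSpace.basisFun_apply]
    refine Finset.sum_congr rfl fun i _ => ?_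
    have : (∑ j, (W x) j • (EuclideanSpace.single j (1:ℝ) : Eucl n)) = W x := by
      simpa using (EuclideanSpace.basisFun (Fin n) ℝ).sum_repr (W x)
    rw [map_smul, real_inner_smul_right, this]
    ring
  simp only [add_apply, smul_apply,
    ContinuousLinearMap.smulRight_apply, ContinuousLinearMap.comp_apply, innerSL_apply_apply,
    PiLp.add_apply, PiLp.smul_apply, smul_eq_mul]
  rw [Finset.sum_add_distrib, ← Finset.mul_sum, ← coordTrace]
  have : ∑ i : Fin n, (p - 2) / 2 * s ^ ((p - 2) / 2 - 1) *
      (2 * inner ℝ (W x) (D (EuclideanSpace.single i 1))) * (W x) i =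
      (p - 2) * s ^ ((p - 2) / 2 - 1) * inner ℝ (D (W x)) (W x) := by
    rw [← hDW, Finset.mul_sum]
    exact Finset.sum_congr rfl fun i _ => by ring
  rw [this, hpow, normalizedForm, hsdef]
  ring

/-- The powers |∇φ|^{2-p} and |∇φ|^{p-4} multiply to |∇φ|^{-2}. At critical points both sides
vanish, so the inequality holds on all of U. -/
lemma normalizedForm_le_of_concavityCondition {p c₀ : ℝ} {U : Set (Eucl n)} {φ : Eucl n → ℝ}
    (hU : IsOpen U) (h : ContDiffOn ℝ 2 φ U) (hc : ConcavityCondition p c₀ U φ) {x : Eucl n}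
    (hx : x ∈ U) :
    normalizedForm p (hessian φ x) (∇ φ x) ≤ -c₀ * ‖∇ φ x‖ ^ 2 := by
  by_cases h0 : ∇ φ x = 0
  · rw [h0]; simp [normalizedForm]
  have hpos : 0 < ‖∇ φ x‖ := norm_pos_iff.2 h0
  have h1 := hc x hx h0
  have h2 : pLaplacian p φ x = divergence (fun y => regFlux p 0 (∇ φ y)) x := by
    simp only [pLaplacian, regFlux_zero]
  rw [h2, divergence_regFlux (hasFDerivAt_gradient hU h hx) (by positivity), add_zero, zero_mul,
    add_zero, ← mul_assoc, ← Real.rpow_natCast_mul hpos.le, ← Real.rpow_add hpos] at h1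
  have h3 : (2 - p + (2:ℕ) * ((p - 2) / 2 - 1)) = -(2:ℕ) := by push_cast; ring
  rw [h3, Real.rpow_neg hpos.le, Real.rpow_natCast, inv_mul_le_iff₀ (by positivity)] at h1
  linarith

/-! ### Extending the concavity inequality to vectors near the gradient -/

/-- Near points where the gradient does not vanish identically, every vector close to the gradient
of a function satisfying the concavity condition is a good direction for its Hessian. -/
lemma exists_normalizedForm_le_near_gradient (n : ℕ) (p : ℝ) (hp : 1 < p) (c₀ : ℝ)
    (hc₀ : 0 < c₀) :
    ∃ ε > 0, ∃ c > 0, ∃ η > 0, ∀ (U : Set (Eucl n)) (φ : Eucl n → ℝ) (x₁ : Eucl n) (r : ℝ),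
      IsOpen U → ContDiffOn ℝ 2 φ U → ConcavityCondition p c₀ U φ → 0 < r →
      Metric.ball x₁ (2 * r) ⊆ U →
      (∀ x ∈ Metric.ball x₁ (2 * r), ∀ y ∈ Metric.ball x₁ (2 * r),
        ‖hessian φ x - hessian φ y‖ ≤ η) →
      (∃ y ∈ Metric.ball x₁ (2 * r), ∇ φ y ≠ 0) →
      ∀ x ∈ Metric.ball x₁ r, ∀ q : Eucl n, ‖q - ∇ φ x‖ ≤ c * r →
        normalizedForm p (hessian φ x) q ≤ -ε * ‖q‖ ^ 2 := by
  -- Half of c₀ is kept back to pay for replacing D²φ(y) by D²φ(x).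
  obtain ⟨ε, hε, c, hc, H⟩ := exists_escape p hp (c₀ / 2) (by positivity) n
  set N : ℝ := n + |p - 2| with hN
  have hN0 : 0 ≤ N := by positivity
  -- The first bound controls the linearization error of ∇φ, the second the cost of freezing the
  -- Hessian.
  set η : ℝ := min (c / 2) (c₀ / (2 * (N + 1))) with hη
  have hη0 : 0 < η := by positivity
  have hη1 : N * η ≤ c₀ / 2 := by
    have : η ≤ c₀ / (2 * (N + 1)) := min_le_right _ _
    rw [le_div_iff₀ (by positivity)] at this
    nlinarith
  refine ⟨ε, hε, c / 2, by positivity, η, hη0, ?_⟩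
  intro U φ x₁ r hU hφ hcon hr hsub hmod ⟨y₀, hy₀, hy₀ne⟩ x hx q hq
  have hx2 : x ∈ Metric.ball x₁ (2 * r) := Metric.ball_subset_ball (by linarith) hx
  have hgood : ∀ y ∈ Metric.ball x₁ (2 * r),
      normalizedForm p (hessian φ x) (∇ φ y) ≤ -(c₀ / 2) * ‖∇ φ y‖ ^ 2 := by
    intro y hy
    have h1 := normalizedForm_le_of_concavityCondition hU hφ hcon (hsub hy)
    have h2 := (abs_le.1 (abs_normalizedForm_sub_le p (hessian φ x) (hessian φ y) (∇ φ y))).2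
    have h3 : N * ‖hessian φ x - hessian φ y‖ * ‖∇ φ y‖ ^ 2 ≤ c₀ / 2 * ‖∇ φ y‖ ^ 2 := by
      gcongr
      calc N * ‖hessian φ x - hessian φ y‖ ≤ N * η := by gcongr; exact hmod x hx2 y hy
        _ ≤ _ := hη1
    linarith
  by_contra! hbad
  obtain ⟨e, he, hw⟩ := H (hessian φ x) q (∇ φ y₀) r (hessian_isSymmetric hU hφ (hsub hx2)) hr
    hy₀ne (hgood y₀ hy₀) hbad
  -- At this point ∇φ(y) = q + rAe + w with |w| ≤ c r. The form at ∇φ(y) would then exceed the bound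
  -- that holds for every gradient of φ in the ball.
  set y := x + r • e with hy
  have hyx : ‖y - x‖ = r := by
    rw [hy, add_sub_cancel_left, norm_smul, he, Real.norm_eq_abs, abs_of_pos hr, mul_one]
  have hyb : y ∈ Metric.ball x₁ (2 * r) := by
    rw [Metric.mem_ball] at hx ⊢
    have := dist_triangle y x x₁
    rw [dist_eq_norm y x, hyx] at this
    linarith
  have hmv : ‖∇ φ y - ∇ φ x - hessian φ x (y - x)‖ ≤ η * ‖y - x‖ :=
    (convex_ball x₁ (2 * r)).norm_image_sub_le_of_norm_hasFDerivWithin_le'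
      (fun z hz => (hasFDerivAt_gradient hU hφ (hsub hz)).hasFDerivWithinAt)
      (fun z hz => hmod z hz x hx2) hx2 hyb
  rw [hyx] at hmv
  have hAe : hessian φ x (y - x) = r • hessian φ x e := by
    rw [hy, add_sub_cancel_left, map_smul]
  rw [hAe] at hmv
  have hwn : ‖∇ φ y - q - r • hessian φ x e‖ ≤ c * r := by
    have : ∇ φ y - q - r • hessian φ x e =
        (∇ φ y - ∇ φ x - r • hessian φ x e) - (q - ∇ φ x) := by abel
    rw [this]
    have h1 : η * r ≤ c / 2 * r := by gcongr; exact min_le_left _ _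
    calc _ ≤ _ := norm_sub_le _ _
      _ ≤ c / 2 * r + c / 2 * r := add_le_add (hmv.trans h1) hq
      _ = c * r := by ring
  have h1 := hw _ hwn
  have h2 : q + r • hessian φ x e + (∇ φ y - q - r • hessian φ x e) = ∇ φ y := by abel
  rw [h2] at h1
  have := hgood y hyb
  linarith

/-! ### Test functions and integration by parts -/

section TestFunctions

variable {U : Set (Eucl n)} {ζ : Eucl n → ℝ}

lemma IsTestFunction.mono {V : Set (Eucl n)} (h : IsTestFunction U ζ) (hUV : U ⊆ V) :
    IsTestFunction V ζ := ⟨h.1, h.2.1, h.2.2.trans hUV⟩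

lemma IsTestFunction.differentiable (h : IsTestFunction U ζ) : Differentiable ℝ ζ :=
  h.1.differentiable (by simp)

lemma IsTestFunction.continuous_gradient (h : IsTestFunction U ζ) : Continuous (∇ ζ) := by
  rw [gradient_eq_comp]
  exact (InnerProductSpace.toDual ℝ (Eucl n)).symm.continuous.comp
    (h.1.continuous_fderiv (by simp))

lemma tsupport_gradient_subset (ζ : Eucl n → ℝ) : tsupport (∇ ζ) ⊆ tsupport ζ := by
  rw [gradient_eq_comp]
  refine (closure_mono ?_).trans (tsupport_fderiv_subset ℝ (f := ζ))
  intro x hx h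
  apply hx
  simp only [h, map_zero]

lemma gradient_eq_zero_of_notMem_tsupport {x : Eucl n} (hx : x ∉ tsupport ζ) : ∇ ζ x = 0 :=
  image_eq_zero_of_notMem_tsupport fun h => hx (tsupport_gradient_subset ζ h)

lemma IsTestFunction.hasCompactSupport_gradient (h : IsTestFunction U ζ) :
    HasCompactSupport (∇ ζ) :=
  h.2.1.of_isClosed_subset (isClosed_tsupport _) (tsupport_gradient_subset ζ)

lemma gradient_apply (ζ : Eucl n → ℝ) (x : Eucl n) (i : Fin n) :
    (∇ ζ x) i = fderiv ℝ ζ x (EuclideanSpace.single i 1) := by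
  rw [← inner_gradient_left, EuclideanSpace.inner_single_right]; simp

/-- A continuous function on `U` times a continuous function with compact support in `U` is
integrable. -/
lemma integrable_mul_of_tsupport_subset {f η : Eucl n → ℝ} (hU : IsOpen U)
    (hf : ContinuousOn f U) (hη : Continuous η) (hηc : HasCompactSupport η)
    (hηU : tsupport η ⊆ U) : Integrable fun x => f x * η x := by
  have hc : HasCompactSupport fun x => f x * η x := hηc.mul_left
  refine Continuous.integrable_of_hasCompactSupport ?_ hc
  refine (hf.mul hη.continuousOn).continuous_of_tsupport_subset hU ?_
  exact (tsupport_mul_subset_right).trans hηU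

lemma IsTestFunction.continuous_of_eq_zero {F : Type*} [NormedAddCommGroup F]
    (hζ : IsTestFunction U ζ) (hU : IsOpen U) {g : Eucl n → F} (hg : ContinuousOn g U)
    (h0 : ∀ x, x ∉ tsupport ζ → g x = 0) : Continuous g := by
  refine hg.continuous_of_tsupport_subset hU (Subset.trans ?_ hζ.2.2)
  refine closure_minimal (fun x hx => ?_) (isClosed_tsupport _)
  by_contra h
  exact hx (h0 x h)

lemma IsTestFunction.integrable_of_eq_zero {F : Type*} [NormedAddCommGroup F]
    (hζ : IsTestFunction U ζ) (hU : IsOpen U) {g : Eucl n → F} (hg : ContinuousOn g U)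
    (h0 : ∀ x, x ∉ tsupport ζ → g x = 0) : Integrable g :=
  (hζ.continuous_of_eq_zero hU hg h0).integrable_of_hasCompactSupport
    (HasCompactSupport.intro hζ.2.1 fun x hx => h0 x hx)

/-- Integration by parts against a test function, for scalar functions of class `C¹`. -/
lemma integral_mul_fderiv_test {f : Eucl n → ℝ} (hU : IsOpen U) (hf : ContDiffOn ℝ 1 f U)
    (hζ : IsTestFunction U ζ) (v : Eucl n) :
    ∫ x, f x * fderiv ℝ ζ x v = -∫ x, fderiv ℝ f x v * ζ x := by
  have hdc : Continuous fun x => fderiv ℝ ζ x v :=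
    (hζ.1.continuous_fderiv (by simp)).clm_apply continuous_const
  have hdsub : tsupport (fun x => fderiv ℝ ζ x v) ⊆ tsupport ζ :=
    (tsupport_fderiv_apply_subset ℝ v)
  refine integral_bilinear_hasFDerivAt_right_eq_neg_left_of_integrable
    (B := ContinuousLinearMap.mul ℝ ℝ) (f' := fderiv ℝ f) (g' := fderiv ℝ ζ) ?_ ?_ ?_ ?_ ?_
  · refine integrable_mul_of_tsupport_subset hU ?_ hζ.1.continuous hζ.2.1 hζ.2.2
    exact (hf.continuousOn_fderiv_of_isOpen hU le_rfl).clm_apply continuousOn_const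
  · exact integrable_mul_of_tsupport_subset hU hf.continuousOn hdc
      (hζ.2.1.of_isClosed_subset (isClosed_tsupport _) hdsub) (hdsub.trans hζ.2.2)
  · exact integrable_mul_of_tsupport_subset hU hf.continuousOn hζ.1.continuous hζ.2.1 hζ.2.2
  · intro x hx
    exact (((hf.contDiffAt (hU.mem_nhds (hζ.2.2 hx)))).differentiableAt one_ne_zero).hasFDerivAt
  · intro x _
    exact (hζ.differentiable x).hasFDerivAt

lemma setIntegral_eq_integral_of_tsupport {F : Type*} [NormedAddCommGroup F] [NormedSpace ℝ F]
    {g : Eucl n → F} (h : ∀ x, x ∉ tsupport ζ → g x = 0) (hζ : tsupport ζ ⊆ U) :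
    ∫ x in U, g x = ∫ x, g x :=
  setIntegral_eq_integral_of_forall_compl_eq_zero fun x hx => h x fun hx' => hx (hζ hx')

/-- Integration by parts against a test function, for vector fields of class `C¹`. -/
lemma integral_inner_gradient_test {V : Eucl n → Eucl n} (hU : IsOpen U)
    (hV : ContDiffOn ℝ 1 V U) (hζ : IsTestFunction U ζ) :
    ∫ x, inner ℝ (V x) (∇ ζ x) = -∫ x, divergence V x * ζ x := by
  have hcomp : ∀ i : Fin n, ContDiffOn ℝ 1 (fun x => V x i) U := fun i =>
    (EuclideanSpace.proj i : Eucl n →L[ℝ] ℝ).contDiff.comp_contDiffOn hV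
  have hd : ∀ x ∈ U, ∀ i : Fin n, ∀ v, fderiv ℝ (fun x => V x i) x v = (fderiv ℝ V x v) i := by
    intro x hx i v
    have h1 : HasFDerivAt V (fderiv ℝ V x) x :=
      ((hV.contDiffAt (hU.mem_nhds hx)).differentiableAt one_ne_zero).hasFDerivAt
    have h2 : HasFDerivAt (fun x => V x i)
        ((EuclideanSpace.proj i : Eucl n →L[ℝ] ℝ).comp (fderiv ℝ V x)) x :=
      ((EuclideanSpace.proj i : Eucl n →L[ℝ] ℝ).hasFDerivAt).comp x h1
    rw [h2.fderiv]; rfl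
  have h1 : ∀ x, inner ℝ (V x) (∇ ζ x) =
      ∑ i : Fin n, V x i * fderiv ℝ ζ x (EuclideanSpace.single i 1) := by
    intro x
    rw [PiLp.inner_apply]
    refine Finset.sum_congr rfl fun i _ => ?_
    rw [gradient_apply]; simp [mul_comm]
  have h2 : ∀ x, divergence V x * ζ x =
      ∑ i : Fin n, fderiv ℝ (fun x => V x i) x (EuclideanSpace.single i 1) * ζ x := by
    intro x
    by_cases hx : x ∈ tsupport ζ
    · rw [divergence, Finset.sum_mul]
      exact Finset.sum_congr rfl fun i _ => by rw [hd x (hζ.2.2 hx)]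
    · simp [image_eq_zero_of_notMem_tsupport hx]
  have hdsub : ∀ v, tsupport (fun x => fderiv ℝ ζ x v) ⊆ tsupport ζ := fun v =>
    (tsupport_fderiv_apply_subset ℝ v)
  simp_rw [h1, h2]
  rw [integral_finsetSum, integral_finsetSum, ← Finset.sum_neg_distrib]
  · exact Finset.sum_congr rfl fun i _ => integral_mul_fderiv_test hU (hcomp i) hζ _
  · intro i _
    refine integrable_mul_of_tsupport_subset hU ?_ hζ.1.continuous hζ.2.1 hζ.2.2
    exact ((hcomp i).continuousOn_fderiv_of_isOpen hU le_rfl).clm_apply continuousOn_const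
  · intro i _
    exact integrable_mul_of_tsupport_subset hU (hcomp i).continuousOn
      ((hζ.1.continuous_fderiv (by simp)).clm_apply continuous_const)
      (hζ.2.1.of_isClosed_subset (isClosed_tsupport _) (hdsub _)) ((hdsub _).trans hζ.2.2)

/-- The classical gradient of a `C¹` function is its weak gradient. -/
lemma integral_smul_gradient_test {f : Eucl n → ℝ} (hU : IsOpen U) (hf : ContDiffOn ℝ 1 f U)
    (hζ : IsTestFunction U ζ) : ∫ x in U, f x • ∇ ζ x = -∫ x in U, ζ x • ∇ f x := by
  rw [setIntegral_eq_integral_of_tsupport (ζ := ζ) (fun x hx => by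
      rw [gradient_eq_zero_of_notMem_tsupport hx, smul_zero]) hζ.2.2,
    setIntegral_eq_integral_of_tsupport (ζ := ζ) (fun x hx => by
      rw [image_eq_zero_of_notMem_tsupport hx, zero_smul]) hζ.2.2]
  have hgc : ContinuousOn (∇ f) U := by
    rw [gradient_eq_comp]
    exact (InnerProductSpace.toDual ℝ (Eucl n)).symm.continuous.comp_continuousOn
      (hf.continuousOn_fderiv_of_isOpen hU le_rfl)
  have hi1 : Integrable fun x => f x • ∇ ζ x :=
    hζ.integrable_of_eq_zero hU (hf.continuousOn.smul hζ.continuous_gradient.continuousOn)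
      fun x hx => by rw [gradient_eq_zero_of_notMem_tsupport hx, smul_zero]
  have hi2 : Integrable fun x => ζ x • ∇ f x :=
    hζ.integrable_of_eq_zero hU (hζ.1.continuous.continuousOn.smul hgc)
      fun x hx => by rw [image_eq_zero_of_notMem_tsupport hx, zero_smul]
  refine ext_inner_right ℝ fun v => ?_
  rw [inner_neg_left, real_inner_comm, real_inner_comm v, ← integral_inner hi1,
    ← integral_inner hi2]
  have := integral_mul_fderiv_test hU hf hζ v
  have e1 : ∀ x, inner ℝ v (f x • ∇ ζ x) = f x * fderiv ℝ ζ x v := fun x => by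
    rw [real_inner_smul_right, real_inner_comm, inner_gradient_left]
  have e2 : ∀ x, inner ℝ v (ζ x • ∇ f x) = fderiv ℝ f x v * ζ x := fun x => by
    rw [real_inner_smul_right, real_inner_comm, inner_gradient_left, mul_comm]
  simp_rw [e1, e2]
  exact this

end TestFunctions

/-! ### From pointwise to weak supersolutions -/

lemma contDiffOn_regFlux_comp {p δ : ℝ} (hδ : 0 < δ) {W : Eucl n → Eucl n} {U : Set (Eucl n)}
    (hW : ContDiffOn ℝ 1 W U) : ContDiffOn ℝ 1 (fun x => regFlux p δ (W x)) U := by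
  unfold regFlux
  have h : ContDiffOn ℝ 1 (fun x => (‖W x‖ ^ 2 + δ) ^ ((p - 2) / 2)) U :=
    ContDiffOn.rpow_const_of_ne (((hW.norm_sq ℝ)).add contDiffOn_const) fun x _ => by positivity
  exact h.smul hW

lemma tendsto_regFlux {p : ℝ} (v : Eucl n) {δ : ℕ → ℝ} (hδ : Tendsto δ atTop (𝓝 0)) :
    Tendsto (fun k => regFlux p (δ k) v) atTop (𝓝 (flux p v)) := by
  by_cases hv : v = 0
  · subst hv; simp [regFlux, flux]
  · rw [← regFlux_zero]
    unfold regFlux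
    refine Tendsto.smul_const ?_ v
    have h : ‖v‖ ^ 2 + 0 ≠ 0 := by have := norm_pos_iff.2 hv; positivity
    exact ((tendsto_const_nhds.add hδ)).rpow_const (Or.inl h)

/-- A `C²` function which is a classical supersolution of the regularized equations is a weak
`p`-supersolution. -/
lemma isWeaklyPSuperharmonic_gradient {p : ℝ} (hp : 1 < p) {U : Set (Eucl n)} {ψ : Eucl n → ℝ}
    (hU : IsOpen U) (hψ : ContDiffOn ℝ 2 ψ U) {δ₀ : ℝ} (hδ₀ : 0 < δ₀)
    (h : ∀ x ∈ U, ∀ δ ∈ Ioo 0 δ₀,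
      normalizedForm p (hessian ψ x) (∇ ψ x) + δ * coordTrace (hessian ψ x) ≤ 0) :
    IsWeaklyPSuperharmonic p U (∇ ψ) := by
  intro ζ hζ hζ0
  rw [setIntegral_eq_integral_of_tsupport (ζ := ζ) (fun x hx => by
      rw [gradient_eq_zero_of_notMem_tsupport hx, inner_zero_right]) hζ.2.2]
  -- The sequence stays in (0, δ₀), where the sign hypothesis applies, and below 1, which gives a
  -- dominating constant independent of k.
  set δ : ℕ → ℝ := fun k => min 1 (δ₀ / 2) / (k + 1) with hδdef
  have hm : 0 < min 1 (δ₀ / 2) := by positivity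
  have hδpos : ∀ k, 0 < δ k := fun k => by positivity
  have hδle : ∀ k, δ k ≤ min 1 (δ₀ / 2) := fun k => by
    rw [hδdef]; apply div_le_self hm.le; linarith [(Nat.cast_nonneg k : (0:ℝ) ≤ k)]
  have hδ0 : Tendsto δ atTop (𝓝 0) := by
    have := (tendsto_one_div_add_atTop_nhds_zero_nat (𝕜 := ℝ)).const_mul (min 1 (δ₀ / 2))
    rw [mul_zero] at this
    refine this.congr fun k => ?_
    simp [hδdef, div_eq_mul_inv]
  have hgc := continuousOn_gradient hU hψ
  have hcont : ∀ k, Continuous fun x => inner ℝ (regFlux p (δ k) (∇ ψ x)) (∇ ζ x) := by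
    intro k
    refine hζ.continuous_of_eq_zero hU ?_
      fun x hx => by rw [gradient_eq_zero_of_notMem_tsupport hx, inner_zero_right]
    exact (contDiffOn_regFlux_comp (hδpos k) (contDiffOn_gradient hU hψ)).continuousOn.inner
      hζ.continuous_gradient.continuousOn
  have hnn : ∀ k, 0 ≤ ∫ x, inner ℝ (regFlux p (δ k) (∇ ψ x)) (∇ ζ x) := by
    intro k
    rw [integral_inner_gradient_test hU
      (contDiffOn_regFlux_comp (hδpos k) (contDiffOn_gradient hU hψ)) hζ, ← integral_neg]
    refine integral_nonneg fun x => ?_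
    show 0 ≤ -(divergence (fun x => regFlux p (δ k) (∇ ψ x)) x * ζ x)
    by_cases hx : x ∈ tsupport ζ
    · have hxU := hζ.2.2 hx
      have hs : 0 < ‖∇ ψ x‖ ^ 2 + δ k := by have := hδpos k; positivity
      rw [divergence_regFlux (hasFDerivAt_gradient hU hψ hxU) hs]
      have h1 := h x hxU (δ k) ⟨hδpos k, by
        have := (hδle k).trans (min_le_right _ _); linarith⟩
      have h2 := hζ0 x
      have h3 : 0 ≤ (‖∇ ψ x‖ ^ 2 + δ k) ^ ((p - 2) / 2 - 1) := by positivity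
      have := mul_nonneg (mul_nonneg h3 (neg_nonneg.2 h1)) h2
      linarith
    · simp [image_eq_zero_of_notMem_tsupport hx]
  obtain ⟨M, hM⟩ : ∃ M, ∀ x ∈ tsupport ζ, ‖∇ ψ x‖ ≤ M :=
    IsCompact.exists_bound_of_continuousOn hζ.2.1 (hgc.mono hζ.2.2)
  have hlim : Tendsto (fun k => ∫ x, inner ℝ (regFlux p (δ k) (∇ ψ x)) (∇ ζ x)) atTop
      (𝓝 (∫ x, inner ℝ (flux p (∇ ψ x)) (∇ ζ x))) := by
    refine tendsto_integral_of_dominated_convergence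
      (fun x => (M ^ 2 + 1) ^ ((p - 1) / 2) * ‖∇ ζ x‖) (fun k => (hcont k).aestronglyMeasurable)
      ?_ ?_ ?_
    · exact (hζ.continuous_gradient.norm.integrable_of_hasCompactSupport
        hζ.hasCompactSupport_gradient.norm).const_mul _
    · intro k
      refine Eventually.of_forall fun x => ?_
      by_cases hx : x ∈ tsupport ζ
      · refine (norm_inner_le_norm _ _).trans ?_
        gcongr
        refine (norm_regFlux_le (hδpos k).le _).trans ?_
        have h1 := hM x hx
        have h2 := hδle k
        have h3 := hδpos k
        have h4 := min_le_left 1 (δ₀ / 2)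
        apply Real.rpow_le_rpow (by positivity) _ (by linarith)
        have : ‖∇ ψ x‖ ^ 2 ≤ M ^ 2 := by gcongr
        linarith
      · rw [gradient_eq_zero_of_notMem_tsupport hx]; simp
    · exact Eventually.of_forall fun x => (tendsto_regFlux _ hδ0).inner tendsto_const_nhds
  exact ge_of_tendsto' hlim hnn

/-! ### Convergence of mollifications in L^p -/

section Mollification

open scoped Convolution ENNReal

variable {F : Type*} [NormedAddCommGroup F] [NormedSpace ℝ F]

/-- Convolution with a normed bump function. -/
def mollify (ρ : ContDiffBump (0 : Eucl n)) (f : Eucl n → F) : Eucl n → F :=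
  ρ.normed volume ⋆[ContinuousLinearMap.lsmul ℝ ℝ, volume] f

lemma mollify_congr_ae (ρ : ContDiffBump (0 : Eucl n)) {f g : Eucl n → F}
    (h : f =ᵐ[volume] g) : mollify ρ f = mollify ρ g :=
  convolution_congr _ (ae_eq_refl _) h

lemma mollify_apply (ρ : ContDiffBump (0 : Eucl n)) (f : Eucl n → F) (x : Eucl n) :
    mollify ρ f x = ∫ t, ρ.normed volume t • f (x - t) := rfl

lemma mollify_apply_swap (ρ : ContDiffBump (0 : Eucl n)) (f : Eucl n → F) (x : Eucl n) :
    mollify ρ f x = ∫ t, ρ.normed volume (x - t) • f t := convolution_eq_swap _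

/-- This is Jensen's inequality for the probability measure whose density is the bump. -/
lemma enorm_mollify_rpow_le (ρ : ContDiffBump (0 : Eucl n)) {p : ℝ} (hp : 1 ≤ p)
    {f : Eucl n → F} (hf : StronglyMeasurable f) (x : Eucl n) :
    ‖mollify ρ f x‖ₑ ^ p ≤ ∫⁻ t, ‖ρ.normed volume t‖ₑ * ‖f (x - t)‖ₑ ^ p := by
  have hp0 : 0 < p := by linarith
  have hρm : Measurable fun t => ‖ρ.normed volume t‖ₑ := ρ.continuous_normed.measurable.enorm
  set ν : Measure (Eucl n) := volume.withDensity fun t => ‖ρ.normed volume t‖ₑ with hν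
  have hprob : IsProbabilityMeasure ν := by
    refine ⟨?_⟩
    rw [hν, withDensity_apply _ MeasurableSet.univ, Measure.restrict_univ]
    have := ofReal_integral_eq_lintegral_ofReal (ρ.integrable_normed (μ := volume))
      (Eventually.of_forall ρ.nonneg_normed)
    rw [ρ.integral_normed, ENNReal.ofReal_one] at this
    rw [this]
    refine lintegral_congr fun t => ?_
    rw [Real.enorm_eq_ofReal (ρ.nonneg_normed t)]
  have hfm : Measurable fun t => ‖f (x - t)‖ₑ :=
    hf.enorm.comp (measurable_const.sub measurable_id)
  have hfs : AEStronglyMeasurable (fun t => f (x - t)) ν :=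
    (hf.comp_measurable (measurable_const.sub measurable_id)).aestronglyMeasurable
  have h1 : ‖mollify ρ f x‖ₑ ≤ ∫⁻ t, ‖f (x - t)‖ₑ ∂ν := by
    rw [mollify_apply, hν, lintegral_withDensity_eq_lintegral_mul _ hρm hfm]
    refine (enorm_integral_le_lintegral_enorm _).trans (lintegral_mono fun t => ?_)
    simp [enorm_smul]
  have h2 : ∫⁻ t, ‖f (x - t)‖ₑ ∂ν ≤ (∫⁻ t, ‖f (x - t)‖ₑ ^ p ∂ν) ^ (1 / p) := by
    have h3 := eLpNorm_le_eLpNorm_of_exponent_le (μ := ν) (p := 1) (q := ENNReal.ofReal p)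
      (by simpa using hp) hfs
    rw [eLpNorm_one_eq_lintegral_enorm, eLpNorm_eq_lintegral_rpow_enorm_toReal
      (by simpa using hp0) ENNReal.ofReal_ne_top, ENNReal.toReal_ofReal hp0.le] at h3
    exact h3
  calc ‖mollify ρ f x‖ₑ ^ p ≤ ((∫⁻ t, ‖f (x - t)‖ₑ ^ p ∂ν) ^ (1 / p)) ^ p :=
        ENNReal.rpow_le_rpow (h1.trans h2) hp0.le
    _ = ∫⁻ t, ‖f (x - t)‖ₑ ^ p ∂ν := by
        rw [← ENNReal.rpow_mul, one_div, inv_mul_cancel₀ hp0.ne', ENNReal.rpow_one]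
    _ = _ := by
        rw [hν, lintegral_withDensity_eq_lintegral_mul _ hρm (hfm.pow_const p)]
        rfl

/-- Young's inequality for mollification. -/
lemma eLpNorm_mollify_le (ρ : ContDiffBump (0 : Eucl n)) {p : ℝ} (hp : 1 ≤ p)
    {f : Eucl n → F} (hf : AEStronglyMeasurable f volume) :
    eLpNorm (mollify ρ f) (ENNReal.ofReal p) volume ≤ eLpNorm f (ENNReal.ofReal p) volume := by
  have hp0 : 0 < p := by linarith
  wlog h : StronglyMeasurable f generalizing f
  · have := this hf.stronglyMeasurable_mk.aestronglyMeasurable hf.stronglyMeasurable_mk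
    rwa [← mollify_congr_ae ρ hf.ae_eq_mk, ← eLpNorm_congr_ae hf.ae_eq_mk] at this
  rw [eLpNorm_eq_lintegral_rpow_enorm_toReal (by simpa using hp0) ENNReal.ofReal_ne_top,
    eLpNorm_eq_lintegral_rpow_enorm_toReal (by simpa using hp0) ENNReal.ofReal_ne_top,
    ENNReal.toReal_ofReal hp0.le]
  refine ENNReal.rpow_le_rpow ?_ (by positivity)
  calc ∫⁻ x, ‖mollify ρ f x‖ₑ ^ p
      ≤ ∫⁻ x, ∫⁻ t, ‖ρ.normed volume t‖ₑ * ‖f (x - t)‖ₑ ^ p :=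
        lintegral_mono fun x => enorm_mollify_rpow_le ρ hp h x
    _ = ∫⁻ t, ∫⁻ x, ‖ρ.normed volume t‖ₑ * ‖f (x - t)‖ₑ ^ p := by
        refine lintegral_lintegral_swap (Measurable.aemeasurable ?_)
        exact (ρ.continuous_normed.measurable.enorm.comp measurable_snd).mul
          ((h.enorm.comp (measurable_fst.sub measurable_snd)).pow_const p)
    _ = ∫⁻ t, ‖ρ.normed volume t‖ₑ * ∫⁻ x, ‖f x‖ₑ ^ p := by
        refine lintegral_congr fun t => ?_
        have hm : Measurable fun x => ‖f (x - t)‖ₑ ^ p :=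
          (h.enorm.comp (measurable_id.sub measurable_const)).pow_const p
        rw [lintegral_const_mul _ hm]
        rw [lintegral_sub_right_eq_self (fun x => ‖f x‖ₑ ^ p) t]
    _ = ∫⁻ x, ‖f x‖ₑ ^ p := by
        rw [lintegral_mul_const _ ρ.continuous_normed.measurable.enorm]
        have := ofReal_integral_eq_lintegral_ofReal (ρ.integrable_normed (μ := volume))
          (Eventually.of_forall ρ.nonneg_normed)
        rw [ρ.integral_normed, ENNReal.ofReal_one] at this
        rw [lintegral_congr fun t => Real.enorm_eq_ofReal (ρ.nonneg_normed t), ← this, one_mul]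

lemma convolutionExists_mollify (ρ : ContDiffBump (0 : Eucl n)) {f : Eucl n → F}
    (hf : LocallyIntegrable f volume) :
    ConvolutionExists (ρ.normed volume) f (ContinuousLinearMap.lsmul ℝ ℝ) volume :=
  ρ.hasCompactSupport_normed.convolutionExists_left _ ρ.continuous_normed hf

lemma mollify_sub (ρ : ContDiffBump (0 : Eucl n)) {f g : Eucl n → F}
    (hf : LocallyIntegrable f volume) (hg : LocallyIntegrable g volume) :
    mollify ρ (f - g) = mollify ρ f - mollify ρ g := by
  funext x
  rw [Pi.sub_apply, mollify_apply, mollify_apply, mollify_apply, ← integral_sub]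
  · exact integral_congr_ae (Eventually.of_forall fun t => by simp [smul_sub])
  · exact convolutionExists_mollify ρ hf x
  · exact convolutionExists_mollify ρ hg x

lemma contDiff_mollify (ρ : ContDiffBump (0 : Eucl n)) {f : Eucl n → F}
    (hf : LocallyIntegrable f volume) :
    ContDiff ℝ ((⊤ : ℕ∞) : WithTop ℕ∞) (mollify ρ f) :=
  ρ.hasCompactSupport_normed.contDiff_convolution_left _ ρ.contDiff_normed hf

lemma mollify_eq_zero_of_notMem {ρ : ContDiffBump (0 : Eucl n)} {r : ℝ} (hr : ρ.rOut ≤ r)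
    {g : Eucl n → F} {x : Eucl n} (hx : x ∉ Metric.cthickening r (tsupport g)) :
    mollify ρ g x = 0 := by
  rw [mollify_apply]
  refine integral_eq_zero_of_ae (Eventually.of_forall fun t => ?_)
  show ρ.normed volume t • g (x - t) = 0
  by_cases ht : t ∈ Function.support (ρ.normed volume)
  · rw [ρ.support_normed_eq, mem_ball_zero_iff] at ht
    by_cases hxt : x - t ∈ tsupport g
    · exact absurd (Metric.mem_cthickening_of_dist_le x (x - t) r _ hxt (by
        rw [dist_eq_norm, sub_sub_cancel]; linarith)) hx
    · rw [image_eq_zero_of_notMem_tsupport hxt, smul_zero]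
  · rw [Function.notMem_support.1 ht, zero_smul]

variable [CompleteSpace F]

/-- Mollifications of a compactly supported continuous function converge uniformly. -/
lemma eventually_forall_dist_mollify_le {ρ : ℕ → ContDiffBump (0 : Eucl n)}
    (hρ : Tendsto (fun j => (ρ j).rOut) atTop (𝓝 0)) {g : Eucl n → F} (hg : Continuous g)
    (hgc : HasCompactSupport g) {ε : ℝ} (hε : 0 < ε) :
    ∀ᶠ j in atTop, ∀ x, dist (mollify (ρ j) g x) (g x) ≤ ε := by
  obtain ⟨δ, hδ, H⟩ := Metric.uniformContinuous_iff.1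
    (hgc.uniformContinuous_of_continuous hg) ε hε
  filter_upwards [hρ.eventually_lt_const hδ] with j hj x
  refine ContDiffBump.dist_normed_convolution_le hg.aestronglyMeasurable fun y hy => ?_
  exact (H ((Metric.mem_ball.1 hy).trans hj)).le

/-- Convergence is uniform, and once the bump radius is below 1 the differences are supported in one
fixed compact set of finite measure. -/
lemma tendsto_eLpNorm_mollify_sub_of_continuous {ρ : ℕ → ContDiffBump (0 : Eucl n)}
    (hρ : Tendsto (fun j => (ρ j).rOut) atTop (𝓝 0)) {p : ℝ} (hp : 1 ≤ p) {g : Eucl n → F}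
    (hg : Continuous g) (hgc : HasCompactSupport g) :
    Tendsto (fun j => eLpNorm (mollify (ρ j) g - g) (ENNReal.ofReal p) volume) atTop (𝓝 0) := by
  have hp0 : 0 < p := by linarith
  set K := Metric.cthickening 1 (tsupport g) with hK
  have hKc : IsCompact K := hgc.isCompact.cthickening
  set V : ℝ≥0∞ := volume K ^ (1 / p) with hV
  have hVt : V ≠ ∞ := ENNReal.rpow_ne_top_of_nonneg (by positivity) hKc.measure_lt_top.ne
  have hbd : ∀ ε : ℝ, 0 < ε → ∀ᶠ j in atTop,
      eLpNorm (mollify (ρ j) g - g) (ENNReal.ofReal p) volume ≤ V * ENNReal.ofReal ε := by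
    intro ε hε
    filter_upwards [eventually_forall_dist_mollify_le hρ hg hgc hε,
      hρ.eventually_lt_const one_pos] with j hj hj1
    have hsupp : Function.support (mollify (ρ j) g - g) ⊆ K := by
      intro x hx
      by_contra hxK
      apply hx
      have h1 : g x = 0 := image_eq_zero_of_notMem_tsupport fun h =>
        hxK (Metric.self_subset_cthickening _ h)
      rw [Pi.sub_apply, mollify_eq_zero_of_notMem hj1.le hxK, h1, sub_zero]
    rw [← eLpNorm_restrict_eq_of_support_subset hsupp]
    have h2 := eLpNorm_le_of_ae_bound (p := ENNReal.ofReal p) (μ := volume.restrict K)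
      (f := mollify (ρ j) g - g) (C := ε) (Eventually.of_forall fun x => by
        rw [Pi.sub_apply, ← dist_eq_norm]; exact hj x)
    rw [Measure.restrict_apply_univ, ENNReal.toReal_ofReal hp0.le, ← one_div] at h2
    exact h2
  rw [ENNReal.tendsto_nhds_zero]
  intro ε hε
  have h3 : Tendsto (fun t : ℝ => V * ENNReal.ofReal t) (𝓝[>] 0) (𝓝 0) := by
    have : Tendsto (fun t : ℝ => ENNReal.ofReal t) (𝓝[>] 0) (𝓝 (ENNReal.ofReal 0)) :=
      (ENNReal.continuous_ofReal.tendsto 0).mono_left nhdsWithin_le_nhds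
    have h4 := ENNReal.Tendsto.const_mul (a := V) this (Or.inr hVt)
    simpa using h4
  obtain ⟨t, ht, ht0⟩ := ((h3.eventually_lt_const hε).and self_mem_nhdsWithin).exists
  filter_upwards [hbd t ht0] with j hj
  exact hj.trans ht.le

/-- Mollifications of an `L^p` function converge in `L^p`. -/
lemma tendsto_eLpNorm_mollify_sub {ρ : ℕ → ContDiffBump (0 : Eucl n)}
    (hρ : Tendsto (fun j => (ρ j).rOut) atTop (𝓝 0)) {p : ℝ} (hp : 1 ≤ p) {f : Eucl n → F}
    (hf : MemLp f (ENNReal.ofReal p) volume) :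
    Tendsto (fun j => eLpNorm (mollify (ρ j) f - f) (ENNReal.ofReal p) volume) atTop (𝓝 0) := by
  have hp1 : (1 : ℝ≥0∞) ≤ ENNReal.ofReal p := by simpa using hp
  rw [ENNReal.tendsto_nhds_zero]
  intro ε hε
  rcases eq_or_ne ε ∞ with rfl | hεt
  · exact Eventually.of_forall fun _ => le_top
  have hε3 : ε / 3 ≠ 0 := by simp [hε.ne']
  obtain ⟨g, hgc, hfg, hg, hgL⟩ :=
    hf.exists_hasCompactSupport_eLpNorm_sub_le ENNReal.ofReal_ne_top hε3
  have hfl : LocallyIntegrable f volume := hf.locallyIntegrable hp1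
  have hgl : LocallyIntegrable g volume := hgL.locallyIntegrable hp1
  filter_upwards [ENNReal.tendsto_nhds_zero.1
    (tendsto_eLpNorm_mollify_sub_of_continuous hρ hp hg hgc) (ε / 3)
    (pos_iff_ne_zero.2 hε3)] with j hj
  have hdec : mollify (ρ j) f - f =
      (mollify (ρ j) (f - g) + (mollify (ρ j) g - g)) - (f - g) := by
    rw [mollify_sub _ hfl hgl]; abel
  have hm1 : AEStronglyMeasurable (mollify (ρ j) (f - g)) volume :=
    (contDiff_mollify (ρ j) (hfl.sub hgl)).continuous.aestronglyMeasurable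
  have hm2 : AEStronglyMeasurable (mollify (ρ j) g - g) volume :=
    ((contDiff_mollify (ρ j) hgl).continuous.sub hg).aestronglyMeasurable
  rw [hdec]
  calc _ ≤ eLpNorm (mollify (ρ j) (f - g) + (mollify (ρ j) g - g)) (ENNReal.ofReal p) volume
        + eLpNorm (f - g) (ENNReal.ofReal p) volume :=
        eLpNorm_sub_le (hm1.add hm2) (hf.sub hgL).1 hp1
    _ ≤ (eLpNorm (mollify (ρ j) (f - g)) (ENNReal.ofReal p) volume
        + eLpNorm (mollify (ρ j) g - g) (ENNReal.ofReal p) volume)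
        + eLpNorm (f - g) (ENNReal.ofReal p) volume := by
        gcongr; exact eLpNorm_add_le hm1 hm2 hp1
    _ ≤ (ε / 3 + ε / 3) + ε / 3 := by
        gcongr
        exact (eLpNorm_mollify_le (ρ j) hp (hf.sub hgL).1).trans hfg
    _ = ε := ENNReal.add_thirds ε

end Mollification

/-! ### Weak gradients of mollifications, passage to the limit, cutoffs -/

section Comparison

open scoped Convolution ENNReal

/-- The mollification of a continuous function with compact support and with weak gradient `P` has
the mollification of `P` as its gradient. -/
lemma gradient_mollify (ρ : ContDiffBump (0 : Eucl n)) {g : Eucl n → ℝ} {P : Eucl n → Eucl n}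
    (hg : Continuous g)
    (hw : ∀ ζ : Eucl n → ℝ, IsTestFunction univ ζ → ∫ x, g x • ∇ ζ x = -∫ x, ζ x • P x)
    (x : Eucl n) : ∇ (mollify ρ g) x = mollify ρ P x := by
  set ρn := ρ.normed (volume : Measure (Eucl n)) with hρn
  have hρs : ContDiff ℝ ((⊤ : ℕ∞) : WithTop ℕ∞) ρn := ρ.contDiff_normed
  have hρc : HasCompactSupport ρn := ρ.hasCompactSupport_normed
  have hgl : LocallyIntegrable g volume := hg.locallyIntegrable
  set ζ : Eucl n → ℝ := fun y => ρn (x - y) with hζ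
  have hζt : IsTestFunction univ ζ := by
    refine ⟨hρs.comp (contDiff_const.sub contDiff_id), ?_, subset_univ _⟩
    exact hρc.comp_homeomorph (Homeomorph.subLeft x)
  have hζd : ∀ y v, fderiv ℝ ζ y v = -fderiv ℝ ρn (x - y) v := by
    intro y v
    have h1 : HasFDerivAt ρn (fderiv ℝ ρn (x - y)) (x - y) :=
      (hρs.differentiable (by simp) _).hasFDerivAt
    have h2 : HasFDerivAt (fun y => x - y) (-ContinuousLinearMap.id ℝ (Eucl n)) y := 
      (hasFDerivAt_id y).const_sub x
    have h3 : HasFDerivAt ζ ((fderiv ℝ ρn (x - y)).comp (-ContinuousLinearMap.id ℝ (Eucl n))) y :=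
      h1.comp y h2
    rw [h3.fderiv]; simp
  have hP : mollify ρ P x = -∫ y, g y • ∇ ζ y := by
    rw [hw ζ hζt, neg_neg, mollify_apply_swap]
  have hintg : Integrable fun y => g y • ∇ ζ y :=
    hζt.integrable_of_eq_zero isOpen_univ
      (hg.smul hζt.continuous_gradient).continuousOn
      fun y hy => by rw [gradient_eq_zero_of_notMem_tsupport hy, smul_zero]
  have hd := hρc.hasFDerivAt_convolution_left (ContinuousLinearMap.lsmul ℝ ℝ)
    (hρs.of_le (by simp)) hgl x
  refine ext_inner_right ℝ fun v => ?_
  rw [inner_gradient_left, hP, inner_neg_left, real_inner_comm, ← integral_inner hintg]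
  have hd' : HasFDerivAt (mollify ρ g)
    ((fderiv ℝ ρn ⋆[(ContinuousLinearMap.lsmul ℝ ℝ).precompL (Eucl n), volume] g) x) x := hd
  have hdc : Continuous (fderiv ℝ ρn) := hρs.continuous_fderiv (by simp)
  have hex := (HasCompactSupport.fderiv ℝ hρc).convolutionExists_left
    ((ContinuousLinearMap.lsmul ℝ ℝ).precompL (Eucl n)) hdc hgl x
  rw [hd'.fderiv, convolution_eq_swap, ContinuousLinearMap.integral_apply hex.integrable_swap,
    ← integral_neg]
  refine integral_congr_ae (Eventually.of_forall fun y => ?_)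
  show _ = -inner ℝ v (g y • ∇ ζ y)
  rw [real_inner_smul_right, real_inner_comm, inner_gradient_left, hζd]
  simp [ContinuousLinearMap.precompL_apply]
  ring

/-- Passage to the limit in a product of a bounded sequence, an `L^q` function and a sequence which
converges in `L^p`. -/
lemma tendsto_integral_mul_inner {α : Type*} [MeasurableSpace α] {μ : Measure α}
    {p q : ℝ≥0∞} [ENNReal.HolderTriple q p 1] {a : ℕ → α → ℝ} {b : α → ℝ} {C : ℝ}
    (ha : ∀ j, AEStronglyMeasurable (a j) μ) (hab : ∀ j x, |a j x| ≤ C)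
    (hlim : ∀ x, Tendsto (fun j => a j x) atTop (𝓝 (b x)))
    {H : α → Eucl n} {P : ℕ → α → Eucl n} {Q : α → Eucl n} (hH : MemLp H q μ) (hQ : MemLp Q p μ)
    (hP : ∀ j, MemLp (P j) p μ) (hPQ : Tendsto (fun j => eLpNorm (P j - Q) p μ) atTop (𝓝 0)) :
    Tendsto (fun j => ∫ x, a j x * inner ℝ (H x) (P j x) ∂μ) atTop
      (𝓝 (∫ x, b x * inner ℝ (H x) (Q x) ∂μ)) := by
  have hC : ∀ (x : α), 0 ≤ C := fun x => (abs_nonneg _).trans (hab 0 x)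
  have hinner : ∀ {G : α → Eucl n}, MemLp G p μ →
      eLpNorm (fun x => inner ℝ (H x) (G x)) 1 μ ≤ eLpNorm H q μ * eLpNorm G p μ := by
    intro G hG
    have := eLpNorm_le_eLpNorm_mul_eLpNorm_of_nnnorm (p := q) (q := p) (r := 1) hH.1 hG.1
      (fun v w => inner ℝ v w) 1 (Eventually.of_forall fun x => by
        rw [one_mul]; exact nnnorm_inner_le_nnnorm _ _)
    simpa using this
  have hintg : ∀ {G : α → Eucl n}, MemLp G p μ → Integrable (fun x => inner ℝ (H x) (G x)) μ := by
    intro G hG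
    rw [← memLp_one_iff_integrable]
    exact ⟨hH.1.inner hG.1, (hinner hG).trans_lt (ENNReal.mul_lt_top hH.2 hG.2)⟩
  have hi1 : ∀ j, Integrable (fun x => a j x * inner ℝ (H x) (Q x)) μ := fun j =>
    (hintg hQ).bdd_mul (ha j) (Eventually.of_forall fun x => hab j x)
  have hi2 : ∀ j, Integrable (fun x => a j x * inner ℝ (H x) ((P j - Q) x)) μ := fun j =>
    (hintg ((hP j).sub hQ)).bdd_mul (ha j) (Eventually.of_forall fun x => hab j x)
  have hsplit : ∀ j, ∫ x, a j x * inner ℝ (H x) (P j x) ∂μ =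
      ∫ x, a j x * inner ℝ (H x) (Q x) ∂μ + ∫ x, a j x * inner ℝ (H x) ((P j - Q) x) ∂μ := by
    intro j
    rw [← integral_add (hi1 j) (hi2 j)]
    refine integral_congr_ae (Eventually.of_forall fun x => ?_)
    simp only [Pi.sub_apply, inner_sub_right]
    ring
  simp_rw [hsplit]
  rw [← add_zero (∫ x, b x * inner ℝ (H x) (Q x) ∂μ)]
  refine Tendsto.add ?_ ?_
  · refine tendsto_integral_of_dominated_convergence (fun x => C * |inner ℝ (H x) (Q x)|)
      (fun j => (hi1 j).1) ((hintg hQ).norm.const_mul C) ?_ ?_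
    · intro j
      refine Eventually.of_forall fun x => ?_
      rw [Real.norm_eq_abs, abs_mul]
      gcongr
      exact hab j x
    · exact Eventually.of_forall fun x => (hlim x).mul_const _
  · refine squeeze_zero_norm (a := fun j => |C| * (eLpNorm H q μ * eLpNorm (P j - Q) p μ).toReal)
      ?_ ?_
    · intro j
      have hfin : eLpNorm H q μ * eLpNorm (P j - Q) p μ ≠ ∞ :=
        (ENNReal.mul_lt_top hH.2 ((hP j).sub hQ).2).ne
      calc ‖∫ x, a j x * inner ℝ (H x) ((P j - Q) x) ∂μ‖
          ≤ ∫ x, ‖a j x * inner ℝ (H x) ((P j - Q) x)‖ ∂μ := norm_integral_le_integral_norm _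
        _ ≤ ∫ x, |C| * ‖inner ℝ (H x) ((P j - Q) x)‖ ∂μ := by
            refine integral_mono (hi2 j).norm ((hintg ((hP j).sub hQ)).norm.const_mul _) fun x => ?_
            show ‖a j x * inner ℝ (H x) ((P j - Q) x)‖ ≤ |C| * ‖inner ℝ (H x) ((P j - Q) x)‖
            rw [norm_mul]
            gcongr
            exact (hab j x).trans (le_abs_self C)
        _ = |C| * ∫ x, ‖inner ℝ (H x) ((P j - Q) x)‖ ∂μ := integral_const_mul _ _
        _ ≤ _ := by
            gcongr
            rw [integral_norm_eq_lintegral_enorm (hintg ((hP j).sub hQ)).1,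
              ← eLpNorm_one_eq_lintegral_enorm]
            exact ENNReal.toReal_mono hfin (hinner ((hP j).sub hQ))
    · have h1 : Tendsto (fun j => eLpNorm H q μ * eLpNorm (P j - Q) p μ) atTop (𝓝 0) := by
        simpa using ENNReal.Tendsto.const_mul hPQ (Or.inr hH.2.ne)
      have h2 := ((ENNReal.tendsto_toReal ENNReal.zero_ne_top).comp h1).const_mul |C|
      simpa using h2

/-- A smooth cutoff function for a compact subset of an open set. -/
lemma exists_cutoff {K U : Set (Eucl n)} (hK : IsCompact K) (hU : IsOpen U) (hKU : K ⊆ U) :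
    ∃ χ : Eucl n → ℝ, IsTestFunction U χ ∧ (∀ x, χ x ∈ Icc (0:ℝ) 1) ∧
      ∀ᶠ x in 𝓝ˢ K, χ x = 1 := by
  obtain ⟨L, hL, hKL, hLU⟩ := exists_compact_between hK hU hKU
  obtain ⟨f, h1, h0, hf⟩ := exists_contMDiffMap_one_nhds_of_subset_interior
    (modelWithCornersSelf ℝ (Eucl n)) (n := (⊤ : ℕ∞)) hK.isClosed hKL
  have hts : tsupport f ⊆ L := closure_minimal (fun x hx => by
    by_contra h; exact hx (h0 x h)) hL.isClosed
  exact ⟨f, ⟨contMDiff_iff_contDiff.1 f.contMDiff,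
    hL.of_isClosed_subset (isClosed_tsupport _) hts, hts.trans hLU⟩, hf, h1⟩

end Comparison

/-! ### The weak comparison principle -/

section WeakComparison

open scoped ENNReal

lemma gradient_mul {f g : Eucl n → ℝ} {x : Eucl n} (hf : DifferentiableAt ℝ f x)
    (hg : DifferentiableAt ℝ g x) :
    ∇ (fun y => f y * g y) x = f x • ∇ g x + g x • ∇ f x := by
  refine ext_inner_right ℝ fun v => ?_
  have h : HasFDerivAt (fun y => f y * g y) (f x • fderiv ℝ g x + g x • fderiv ℝ f x) x :=
    hf.hasFDerivAt.mul hg.hasFDerivAt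
  rw [inner_gradient_left, inner_add_left, real_inner_smul_left, real_inner_smul_left,
    inner_gradient_left, inner_gradient_left, h.fderiv]
  simp

lemma gradient_comp_deriv {Θ : ℝ → ℝ} {g : Eucl n → ℝ} {x : Eucl n}
    (hΘ : DifferentiableAt ℝ Θ (g x)) (hg : DifferentiableAt ℝ g x) :
    ∇ (fun y => Θ (g y)) x = deriv Θ (g x) • ∇ g x := by
  refine ext_inner_right ℝ fun v => ?_
  have h : HasFDerivAt (fun y => Θ (g y)) (deriv Θ (g x) • fderiv ℝ g x) x :=
    hΘ.hasDerivAt.comp_hasFDerivAt x hg.hasFDerivAt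
  rw [inner_gradient_left, real_inner_smul_left, inner_gradient_left, h.fderiv]
  simp

lemma IsTestFunction.mul_left {U V : Set (Eucl n)} {χ ζ : Eucl n → ℝ} (hχ : IsTestFunction U χ)
    (hζ : IsTestFunction V ζ) : IsTestFunction U fun x => χ x * ζ x :=
  ⟨hχ.1.mul hζ.1, hχ.2.1.mul_right, (tsupport_mul_subset_left).trans hχ.2.2⟩

/-- Multiplication by a cutoff function turns a local weak gradient into a global one. -/
lemma weak_gradient_cutoff {p : ℝ} (hp : 1 < p) {U : Set (Eucl n)} (hU : IsOpen U)
    {f χ : Eucl n → ℝ} {F : Eucl n → Eucl n} (hf : ContinuousOn f U) (hF : MemLpLoc p U F)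
    (hw : ∀ ζ, IsTestFunction U ζ → ∫ x in U, f x • ∇ ζ x = -∫ x in U, ζ x • F x)
    (hχ : IsTestFunction U χ) (hχ1 : ∀ x, χ x ∈ Icc (0 : ℝ) 1) :
    MemLp (fun x => χ x • F x + f x • ∇ χ x) (ENNReal.ofReal p) volume ∧
    ∀ ζ, IsTestFunction univ ζ → ∫ x, (χ x * f x) • ∇ ζ x =
      -∫ x, ζ x • (χ x • F x + f x • ∇ χ x) := by
  have hp1 : (1 : ℝ≥0∞) ≤ ENNReal.ofReal p := by simpa using hp.le
  set S := tsupport χ with hS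
  have hSm : MeasurableSet S := (isClosed_tsupport χ).measurableSet
  have hFS : MemLp (S.indicator F) (ENNReal.ofReal p) volume :=
    (memLp_indicator_iff_restrict hSm).2 (hF S hχ.2.1 hχ.2.2)
  have hχF : ∀ x, χ x • F x = χ x • S.indicator F x := by
    intro x
    by_cases hx : x ∈ S
    · rw [indicator_of_mem hx]
    · rw [image_eq_zero_of_notMem_tsupport hx, zero_smul, zero_smul]
  have hχFL : MemLp (fun x => χ x • F x) (ENNReal.ofReal p) volume := by
    simp_rw [hχF]
    refine hFS.of_le (hχ.1.continuous.aestronglyMeasurable.smul hFS.1)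
      (Eventually.of_forall fun x => ?_)
    rw [norm_smul, Real.norm_eq_abs, abs_of_nonneg (hχ1 x).1]
    exact mul_le_of_le_one_left (norm_nonneg _) (hχ1 x).2
  have hfc : Continuous fun x => f x • ∇ χ x :=
    hχ.continuous_of_eq_zero hU (hf.smul hχ.continuous_gradient.continuousOn)
      fun x hx => by rw [gradient_eq_zero_of_notMem_tsupport hx, smul_zero]
  have hfcs : HasCompactSupport fun x => f x • ∇ χ x :=
    HasCompactSupport.intro hχ.2.1
      fun x hx => by rw [gradient_eq_zero_of_notMem_tsupport hx, smul_zero]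
  refine ⟨hχFL.add (hfc.memLp_of_hasCompactSupport hfcs), fun ζ hζ => ?_⟩
  have hχζ := hχ.mul_left hζ
  have h := hw _ hχζ
  have hgr : ∀ x, ∇ (fun y => χ y * ζ y) x = χ x • ∇ ζ x + ζ x • ∇ χ x := fun x =>
    gradient_mul (hχ.differentiable x) (hζ.differentiable x)
  rw [setIntegral_eq_integral_of_tsupport (ζ := fun x => χ x * ζ x) (fun x hx => by
      rw [gradient_eq_zero_of_notMem_tsupport hx, smul_zero]) hχζ.2.2,
    setIntegral_eq_integral_of_tsupport (ζ := fun x => χ x * ζ x) (fun x hx => by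
      rw [image_eq_zero_of_notMem_tsupport (f := fun x => χ x * ζ x) hx, zero_smul]) hχζ.2.2] at h
  simp_rw [hgr] at h
  have i1 : Integrable fun x => (χ x * f x) • ∇ ζ x :=
    hχ.integrable_of_eq_zero hU
      ((hχ.1.continuous.continuousOn.mul hf).smul hζ.continuous_gradient.continuousOn)
      fun x hx => by rw [image_eq_zero_of_notMem_tsupport hx, zero_mul, zero_smul]
  have i2 : Integrable fun x => ζ x • (f x • ∇ χ x) :=
    (hζ.1.continuous.smul hfc).integrable_of_hasCompactSupport hfcs.smul_left
  have i3 : Integrable fun x => ζ x • (χ x • F x) :=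
    (hχFL.locallyIntegrable hp1).integrable_smul_left_of_hasCompactSupport hζ.1.continuous hζ.2.1
  have e1 : ∫ x, f x • (χ x • ∇ ζ x + ζ x • ∇ χ x) =
      (∫ x, (χ x * f x) • ∇ ζ x) + ∫ x, ζ x • (f x • ∇ χ x) := by
    rw [← integral_add i1 i2]
    refine integral_congr_ae (Eventually.of_forall fun x => ?_)
    simp only [smul_add, smul_smul]
    rw [mul_comm (f x) (χ x), mul_comm (f x) (ζ x)]
  have e2 : ∫ x, (χ x * ζ x) • F x = ∫ x, ζ x • (χ x • F x) := by
    refine integral_congr_ae (Eventually.of_forall fun x => ?_)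
    simp only [smul_smul]
    rw [mul_comm]
  have e3 : ∫ x, ζ x • (χ x • F x + f x • ∇ χ x) =
      (∫ x, ζ x • (χ x • F x)) + ∫ x, ζ x • (f x • ∇ χ x) := by
    rw [← integral_add i3 i2]
    exact integral_congr_ae (Eventually.of_forall fun x => by simp only [smul_add])
  rw [e1, e2] at h
  rw [e3, neg_add, ← h]
  abel

lemma exists_bump_sequence (n : ℕ) : ∃ ρ : ℕ → ContDiffBump (0 : Eucl n),
    Tendsto (fun j => (ρ j).rOut) atTop (𝓝 0) := by
  refine ⟨fun j => ⟨1 / ((j : ℝ) + 2), 1 / ((j : ℝ) + 1), by positivity, ?_⟩, ?_⟩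
  · exact one_div_lt_one_div_of_lt (by positivity) (by linarith)
  · exact tendsto_one_div_add_atTop_nhds_zero_nat (𝕜 := ℝ)

/-- **Weak comparison principle.** Let `F` be the weak gradient of `f`, and let `H` be a vector
field with `div H ≥ 0` weakly and `⟨H, F⟩ > 0` wherever `F ≠ 0`. If the set `{f ≥ k}` is compactly
contained in `U`, then `f ≤ k`. -/
theorem weak_comparison (hn : 0 < n) {p q : ℝ} (hpq : q.HolderConjugate p) {U K : Set (Eucl n)}
    (hU : IsOpen U) (hK : IsCompact K) (hKU : K ⊆ U) {f : Eucl n → ℝ} {F H : Eucl n → Eucl n}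
    (hf : ContinuousOn f U) (hF : MemLpLoc p U F)
    (hw : ∀ ζ, IsTestFunction U ζ → ∫ x in U, f x • ∇ ζ x = -∫ x in U, ζ x • F x)
    (hHL : MemLpLoc q U H) (hpos : ∀ x, F x ≠ 0 → 0 < inner ℝ (H x) (F x))
    (hH : ∀ ζ, IsTestFunction U ζ → (∀ x, 0 ≤ ζ x) → ∫ x in U, inner ℝ (H x) (∇ ζ x) ≤ 0)
    {k : ℝ} (hk : 0 < k) (hfK : ∀ x ∈ U, k ≤ f x → x ∈ K) : ∀ x ∈ U, f x ≤ k := by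
  by_contra! hcon
  obtain ⟨z, hzU, hz⟩ := hcon
  have hp : 1 < p := hpq.symm.lt
  have hp1 : (1 : ℝ≥0∞) ≤ ENNReal.ofReal p := by simpa using hp.le
  have : (ENNReal.ofReal q).HolderConjugate (ENNReal.ofReal p) := hpq.ennrealOfReal
  obtain ⟨χ, hχ, hχ1, hχK⟩ := exists_cutoff hK hU hKU
  obtain ⟨hPL, hPw⟩ := weak_gradient_cutoff hp hU hf hF hw hχ hχ1
  set g : Eucl n → ℝ := fun x => χ x * f x with hgdef
  set P : Eucl n → Eucl n := fun x => χ x • F x + f x • ∇ χ x with hPdef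
  have hgc : Continuous g := hχ.continuous_of_eq_zero hU (hχ.1.continuous.continuousOn.mul hf)
    fun x hx => by simp only [hgdef, image_eq_zero_of_notMem_tsupport hx, zero_mul]
  have hgs : HasCompactSupport g := HasCompactSupport.intro hχ.2.1
    fun x hx => by simp only [hgdef, image_eq_zero_of_notMem_tsupport hx, zero_mul]
  have hgk : ∀ x, k ≤ g x → x ∈ K := by
    intro x hx
    have hxU : x ∈ U := by
      by_contra h
      have : χ x = 0 := image_eq_zero_of_notMem_tsupport fun h' => h (hχ.2.2 h')
      simp only [hgdef, this, zero_mul] at hx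
      linarith
    refine hfK x hxU ?_
    by_contra! h
    obtain ⟨h0, h1⟩ := hχ1 x
    have hx' : k ≤ χ x * f x := hx
    rcases le_total (f x) 0 with h2 | h2
    · linarith [mul_nonpos_of_nonneg_of_nonpos h0 h2]
    · linarith [mul_le_of_le_one_left h2 h1]
  have hχx : ∀ x ∈ K, χ =ᶠ[𝓝 x] fun _ => 1 := fun x hx =>
    (eventually_nhdsSet_iff_forall.1 hχK) x hx
  have hgK : ∀ x ∈ K, g x = f x := fun x hx => by
    simp only [hgdef, (hχx x hx).eq_of_nhds, one_mul]
  have hPK : ∀ x ∈ K, P x = F x := fun x hx => by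
    simp only [hPdef, (hχx x hx).eq_of_nhds, one_smul, (hχx x hx).gradient_eq, gradient_fun_const,
      smul_zero, add_zero]
  have hzK : z ∈ K := hfK z hzU hz.le
  -- The truncation level lies strictly between k and f(z). The gap k₁ - k keeps the truncated
  -- mollifications supported in K, and k₁ < f(z) keeps the limit nonzero at z.
  set k₁ : ℝ := (k + f z) / 2 with hk₁
  have hkk₁ : k < k₁ := by rw [hk₁]; linarith
  have hk₁z : k₁ < f z := by rw [hk₁]; linarith
  set Θ : ℝ → ℝ := fun t => expNegInvGlue (t - k₁) with hΘ
  have hΘs : ContDiff ℝ ((⊤ : ℕ∞) : WithTop ℕ∞) Θ :=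
    expNegInvGlue.contDiff.comp (contDiff_id.sub contDiff_const)
  have hΘm : Monotone Θ := fun s t hst => expNegInvGlue.monotone (sub_le_sub_right hst _)
  have hΘ0 : ∀ t ≤ k₁, Θ t = 0 := fun t ht => expNegInvGlue.zero_of_nonpos (by linarith)
  have hΘd : Differentiable ℝ Θ := hΘs.differentiable (by simp)
  have hΘ'c : Continuous (deriv Θ) := hΘs.continuous_deriv (by simp)
  have hΘ'n : ∀ t, 0 ≤ deriv Θ t := fun t => hΘm.deriv_nonneg
  obtain ⟨ρ₀, hρ₀⟩ := exists_bump_sequence n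
  set ε : ℝ := min 1 (k₁ - k) with hε
  have hεpos : 0 < ε := lt_min one_pos (by linarith)
  obtain ⟨J, hJ⟩ := eventually_atTop.1 (eventually_forall_dist_mollify_le hρ₀ hgc hgs hεpos)
  -- Dropping the first J bumps makes the uniform error bound hold for every index.
  set ρ : ℕ → ContDiffBump (0 : Eucl n) := fun j => ρ₀ (j + J) with hρdef
  have hρ : Tendsto (fun j => (ρ j).rOut) atTop (𝓝 0) :=
    hρ₀.comp (tendsto_add_atTop_nat J)
  have hρε : ∀ j x, |mollify (ρ j) g x - g x| ≤ ε := fun j x => by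
    rw [← Real.dist_eq]; exact hJ (j + J) (Nat.le_add_left _ _) x
  have hglim : ∀ x, Tendsto (fun j => mollify (ρ j) g x) atTop (𝓝 (g x)) := fun x =>
    ContDiffBump.convolution_tendsto_right_of_continuous hρ hgc x
  obtain ⟨M, hM⟩ := hgs.exists_bound_of_continuous hgc
  have hgj : ∀ j x, mollify (ρ j) g x ∈ Icc (-(M + 1)) (M + 1) := by
    intro j x
    have h1 := abs_le.1 (hρε j x)
    have h2 := hM x
    rw [Real.norm_eq_abs, abs_le] at h2
    have h3 : ε ≤ 1 := min_le_left _ _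
    constructor <;> linarith
  obtain ⟨C, hC⟩ := (isCompact_Icc (a := -(M + 1)) (b := M + 1)).exists_bound_of_continuousOn
    hΘ'c.continuousOn
  have hgl : LocallyIntegrable g volume := hgc.locallyIntegrable
  set ζ : ℕ → Eucl n → ℝ := fun j x => Θ (mollify (ρ j) g x) with hζdef
  have hζ0 : ∀ j x, x ∉ K → ζ j x = 0 := by
    intro j x hx
    refine hΘ0 _ ?_
    by_contra! h
    apply hx
    apply hgk
    have h1 := (abs_le.1 (hρε j x)).2
    have h2 : ε ≤ k₁ - k := min_le_right _ _
    linarith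
  have hζts : ∀ j, tsupport (ζ j) ⊆ K := fun j => closure_minimal (fun x hx => by
    by_contra h; exact hx (hζ0 j x h)) hK.isClosed
  have hζ : ∀ j, IsTestFunction U (ζ j) := fun j =>
    ⟨hΘs.comp (contDiff_mollify (ρ j) hgl),
      hK.of_isClosed_subset (isClosed_tsupport _) (hζts j), (hζts j).trans hKU⟩
  have hζn : ∀ j x, 0 ≤ ζ j x := fun j x => expNegInvGlue.nonneg _
  set a : ℕ → Eucl n → ℝ := fun j x => deriv Θ (mollify (ρ j) g x) with hadef
  set b : Eucl n → ℝ := fun x => deriv Θ (g x) with hbdef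
  have hgrad : ∀ j x, ∇ (ζ j) x = a j x • mollify (ρ j) P x := by
    intro j x
    rw [← gradient_mollify (ρ j) hgc hPw x]
    exact gradient_comp_deriv (hΘd _)
      ((contDiff_mollify (ρ j) hgl).differentiable (by simp) x)
  have hgrad0 : ∀ j x, x ∉ K → ∇ (ζ j) x = 0 := fun j x hx =>
    gradient_eq_zero_of_notMem_tsupport fun h => hx (hζts j h)
  have hlimit : ∀ V : Eucl n → Eucl n, MemLp V (ENNReal.ofReal q) (volume.restrict K) →
      Tendsto (fun j => ∫ x in K, a j x * inner ℝ (V x) (mollify (ρ j) P x)) atTop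
        (𝓝 (∫ x in K, b x * inner ℝ (V x) (P x))) := by
    intro V hV
    have hPl : LocallyIntegrable P volume := hPL.locallyIntegrable hp1
    refine tendsto_integral_mul_inner (p := ENNReal.ofReal p) (q := ENNReal.ofReal q) (C := C)
      (fun j => ?_) (fun j x => ?_) (fun x => ?_) hV (hPL.restrict K) (fun j => ?_) ?_
    · exact (hΘ'c.comp (contDiff_mollify (ρ j) hgl).continuous).aestronglyMeasurable
    · rw [← Real.norm_eq_abs]; exact hC _ (hgj j x)
    · exact (hΘ'c.tendsto _).comp (hglim x)
    · exact MemLp.restrict K ⟨(contDiff_mollify (ρ j) hPl).continuous.aestronglyMeasurable,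
        (eLpNorm_mollify_le (ρ j) hp.le hPL.1).trans_lt hPL.2⟩
    · refine tendsto_of_tendsto_of_tendsto_of_le_of_le tendsto_const_nhds
        (tendsto_eLpNorm_mollify_sub hρ hp.le hPL) (fun _ => zero_le) fun j => ?_
      exact eLpNorm_mono_measure _ Measure.restrict_le_self
  have hKm : MeasurableSet K := hK.isClosed.measurableSet
  have hneg : ∫ x in K, b x * inner ℝ (H x) (P x) ≤ 0 := by
    refine le_of_tendsto' (hlimit H (hHL K hK hKU)) fun j => ?_
    have h1 := hH (ζ j) (hζ j) (hζn j)
    have h2 : ∫ x in U, inner ℝ (H x) (∇ (ζ j) x) = ∫ x in K, inner ℝ (H x) (∇ (ζ j) x) :=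
      setIntegral_eq_of_subset_of_forall_sdiff_eq_zero hU.measurableSet hKU
        fun x hx => by rw [hgrad0 j x hx.2, inner_zero_right]
    rw [h2] at h1
    refine le_trans (le_of_eq ?_) h1
    refine setIntegral_congr_fun hKm fun x _ => ?_
    simp only [hgrad, real_inner_smul_right]
  -- The integrand Θ'(g)⟨H, P⟩ is nonnegative on K with integral ≤ 0, so it vanishes a.e. Strict
  -- positivity of ⟨H, F⟩ then gives Θ'(g)P = 0, the weak form of ∇Θ(g) = 0.
  have hbF : ∀ᵐ x ∂(volume.restrict K), b x • P x = 0 := by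
    have hintg : Integrable (fun x => b x * inner ℝ (H x) (P x)) (volume.restrict K) := by
      have hL : MemLp (fun x => inner ℝ (H x) (P x)) 1 (volume.restrict K) :=
        MemLp.of_bilin (fun v w => inner ℝ v w) 1 (hHL K hK hKU) (hPL.restrict K)
          ((hHL K hK hKU).1.inner (hPL.restrict K).1) (Eventually.of_forall fun x => by
            rw [one_mul]; exact nnnorm_inner_le_nnnorm _ _)
      refine (memLp_one_iff_integrable.1 hL).bdd_mul (c := C)
        (hΘ'c.comp hgc).aestronglyMeasurable (Eventually.of_forall fun x => hC _ ?_)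
      have h2 := hM x
      rw [Real.norm_eq_abs, abs_le] at h2
      constructor <;> linarith
    have hnn : ∀ x ∈ K, 0 ≤ b x * inner ℝ (H x) (P x) := by
      intro x hx
      refine mul_nonneg (hΘ'n _) ?_
      rw [hPK x hx]
      by_cases h : F x = 0
      · rw [h, inner_zero_right]
      · exact (hpos x h).le
    have hnn' : 0 ≤ᵐ[volume.restrict K] fun x => b x * inner ℝ (H x) (P x) :=
      (ae_restrict_iff' hKm).2 (Eventually.of_forall hnn)
    have h0 : ∫ x in K, b x * inner ℝ (H x) (P x) = 0 :=
      le_antisymm hneg (integral_nonneg_of_ae hnn')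
    rw [integral_eq_zero_iff_of_nonneg_ae hnn' hintg] at h0
    filter_upwards [h0, ae_restrict_mem hKm] with x hx hxK
    by_cases h : F x = 0
    · rw [hPK x hxK, h, smul_zero]
    · rw [hPK x hxK] at hx
      have : b x = 0 := (mul_eq_zero.1 hx).resolve_right (hpos x h).ne'
      rw [this, zero_smul]
  set i₀ : Fin n := ⟨0, hn⟩
  set e : Eucl n := EuclideanSpace.single i₀ 1 with he
  -- Integration by parts against the coordinate x_{i₀} takes the place of a Poincaré inequality: ∫
  -- ζ = -∫ x_{i₀} ∂_{i₀} ζ, whose right side tends to 0. This is where n > 0 enters.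
  have hζint : ∀ j, ∫ x in K, ζ j x =
      -∫ x in K, a j x * inner ℝ (x i₀ • e) (mollify (ρ j) P x) := by
    intro j
    have hlin : ContDiff ℝ 1 fun x : Eucl n => x i₀ :=
      (EuclideanSpace.proj i₀ : Eucl n →L[ℝ] ℝ).contDiff
    have h1 := integral_mul_fderiv_test isOpen_univ hlin.contDiffOn
      ((hζ j).mono (subset_univ U)) e
    have h2 : ∀ x : Eucl n, fderiv ℝ (fun x : Eucl n => x i₀) x e = 1 := by
      intro x
      have h3 : HasFDerivAt (fun x : Eucl n => x i₀) (EuclideanSpace.proj i₀ : Eucl n →L[ℝ] ℝ) x :=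
        (EuclideanSpace.proj i₀ : Eucl n →L[ℝ] ℝ).hasFDerivAt
      rw [h3.fderiv]; simp [he]
    simp only [h2, one_mul] at h1
    rw [setIntegral_eq_integral_of_forall_compl_eq_zero (fun x hx => hζ0 j x hx),
      eq_neg_iff_add_eq_zero, add_comm, ← eq_neg_iff_add_eq_zero, ← h1,
      setIntegral_eq_integral_of_forall_compl_eq_zero]
    · refine integral_congr_ae (Eventually.of_forall fun x => ?_)
      show a j x * inner ℝ (x i₀ • e) (mollify (ρ j) P x) = x i₀ * fderiv ℝ (ζ j) x e
      rw [← inner_gradient_left, hgrad, real_inner_smul_left, real_inner_smul_left,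
        real_inner_comm]
      ring
    · intro x hx
      have h3 := hgrad0 j x hx
      rw [hgrad] at h3
      rw [← real_inner_smul_right, h3, inner_zero_right]
  have hVL : MemLp (fun x : Eucl n => x i₀ • e) (ENNReal.ofReal q) (volume.restrict K) := by
    have hc : Continuous fun x : Eucl n => x i₀ • e :=
      (EuclideanSpace.proj i₀ : Eucl n →L[ℝ] ℝ).continuous.smul continuous_const
    have : IsFiniteMeasure (volume.restrict K) := ⟨by
      rw [Measure.restrict_apply_univ]; exact hK.measure_lt_top⟩
    obtain ⟨B, hB⟩ := hK.exists_bound_of_continuousOn hc.continuousOn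
    exact MemLp.of_bound hc.aestronglyMeasurable B
      ((ae_restrict_iff' hKm).2 (Eventually.of_forall hB))
  have hzero : ∫ x in K, b x * inner ℝ (x i₀ • e) (P x) = 0 := by
    refine integral_eq_zero_of_ae ?_
    filter_upwards [hbF] with x hx
    rw [← real_inner_smul_right, hx, inner_zero_right]; rfl
  have hlim1 : Tendsto (fun j => ∫ x in K, ζ j x) atTop (𝓝 0) := by
    have := (hlimit _ hVL).neg
    rw [hzero, neg_zero] at this
    exact this.congr fun j => (hζint j).symm
  have hΘg : Continuous fun x => Θ (g x) := hΘs.continuous.comp hgc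
  have hlim2 : Tendsto (fun j => ∫ x in K, ζ j x) atTop (𝓝 (∫ x in K, Θ (g x))) := by
    have : IsFiniteMeasure (volume.restrict K) := ⟨by
      rw [Measure.restrict_apply_univ]; exact hK.measure_lt_top⟩
    refine tendsto_integral_of_dominated_convergence (fun _ => Θ (M + 1))
      (fun j => (hζ j).1.continuous.aestronglyMeasurable) (integrable_const _) ?_ ?_
    · intro j
      refine Eventually.of_forall fun x => ?_
      rw [Real.norm_eq_abs, abs_of_nonneg (hζn j x)]
      exact hΘm (hgj j x).2
    · exact Eventually.of_forall fun x => (hΘs.continuous.tendsto _).comp (hglim x)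
  have hΘint := tendsto_nhds_unique hlim2 hlim1
  have hΘ0K : ∀ x, x ∉ K → Θ (g x) = 0 := fun x hx => hΘ0 _ (by
    by_contra! h; exact hx (hgk x (hkk₁.trans h).le))
  rw [setIntegral_eq_integral_of_forall_compl_eq_zero hΘ0K] at hΘint
  have hpos' : 0 < ∫ x, Θ (g x) :=
    hΘg.integral_pos_of_hasCompactSupport_nonneg_nonzero (HasCompactSupport.intro hK hΘ0K)
      (fun x => expNegInvGlue.nonneg _) (x := z) (by
        rw [hgK z hzK]
        exact (expNegInvGlue.pos_of_pos (sub_pos.2 hk₁z)).ne')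
  linarith

end WeakComparison

/-! ### Monotonicity of the flux and comparison for the p-Laplacian -/

section FluxComparison

open scoped ENNReal

lemma norm_flux {p : ℝ} (hp : 1 < p) (v : Eucl n) : ‖flux p v‖ = ‖v‖ ^ (p - 1) := by
  by_cases hv : v = 0
  · subst hv
    rw [flux, smul_zero, norm_zero, Real.zero_rpow (by linarith)]
  · have h : 0 < ‖v‖ := norm_pos_iff.2 hv
    rw [flux, norm_smul, Real.norm_eq_abs, abs_of_nonneg (by positivity)]
    nth_rewrite 2 [← Real.rpow_one ‖v‖]
    rw [← Real.rpow_add h]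
    congr 1; ring

lemma flux_neg (p : ℝ) (v : Eucl n) : flux p (-v) = -flux p v := by
  rw [flux, flux, norm_neg, smul_neg]

lemma measurable_flux (p : ℝ) : Measurable (flux p : Eucl n → Eucl n) :=
  (measurable_norm.pow_const _).smul measurable_id

/-- Strict monotonicity of the `p`-Laplace flux. -/
lemma inner_flux_sub_pos {p : ℝ} (hp : 1 < p) {a b : Eucl n} (hab : a ≠ b) :
    0 < inner ℝ (flux p a - flux p b) (a - b) := by
  set A := ‖a‖ with hA
  set B := ‖b‖ with hB
  set α := A ^ (p - 2) with hα
  set β := B ^ (p - 2) with hβ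
  have hα0 : 0 ≤ α := by positivity
  have hβ0 : 0 ≤ β := by positivity
  have hαA : α * A = A ^ (p - 1) := by
    rw [← norm_flux hp a, flux, norm_smul, Real.norm_eq_abs, abs_of_nonneg hα0]
  have hβB : β * B = B ^ (p - 1) := by
    rw [← norm_flux hp b, flux, norm_smul, Real.norm_eq_abs, abs_of_nonneg hβ0]
  -- The first term is nonnegative because t ↦ t^{p-1} is increasing, the second by Cauchy–Schwarz.
  -- Strictness comes from the first when the norms differ and from the second when they agree.
  have hexp : inner ℝ (flux p a - flux p b) (a - b) =
      (α * A - β * B) * (A - B) + (α + β) * (A * B - inner ℝ a b) := by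
    simp only [flux, inner_sub_left, inner_sub_right, real_inner_smul_left,
      real_inner_self_eq_norm_sq, real_inner_comm a b]
    rw [← hA, ← hB, ← hα, ← hβ]
    ring
  have hcs : 0 ≤ A * B - inner ℝ a b := sub_nonneg.2 (real_inner_le_norm a b)
  have h2 : 0 ≤ (α + β) * (A * B - inner ℝ a b) := by positivity
  rw [hexp]
  have hA0 : 0 ≤ A := norm_nonneg a
  have hB0 : 0 ≤ B := norm_nonneg b
  rcases lt_trichotomy A B with h | h | h
  · have h1 : A ^ (p - 1) < B ^ (p - 1) := Real.rpow_lt_rpow hA0 h (by linarith)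
    have : 0 < (α * A - β * B) * (A - B) :=
      mul_pos_of_neg_of_neg (by linarith) (by linarith)
    linarith
  · have hApos : 0 < A := by
      rcases hA0.eq_or_lt with h0 | h0
      · exfalso
        apply hab
        have ha : a = 0 := norm_eq_zero.1 (by rw [← hA, ← h0])
        have hb : b = 0 := norm_eq_zero.1 (by rw [← hB, ← h, ← h0])
        rw [ha, hb]
      · exact h0
    have hα1 : 0 < α := Real.rpow_pos_of_pos hApos _
    have h3 : 0 < ‖a - b‖ ^ 2 := by
      have := norm_pos_iff.2 (sub_ne_zero.2 hab); positivity
    rw [norm_sub_sq_real, ← hA, ← hB, ← h] at h3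
    have h4 : 0 < A * B - inner ℝ a b := by rw [← h]; nlinarith
    rw [h, sub_self, mul_zero, zero_add]
    rw [h] at h4
    positivity
  · have h1 : B ^ (p - 1) < A ^ (p - 1) := Real.rpow_lt_rpow hB0 h (by linarith)
    have : 0 < (α * A - β * B) * (A - B) := mul_pos (by linarith) (by linarith)
    linarith

lemma MemLpLoc.mono {F : Type*} [NormedAddCommGroup F] {p : ℝ} {U V : Set (Eucl n)}
    {f : Eucl n → F} (h : MemLpLoc p V f) (hUV : U ⊆ V) : MemLpLoc p U f :=
  fun K hK hKU => h K hK (hKU.trans hUV)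

lemma MemLpLoc.sub {F : Type*} [NormedAddCommGroup F] {p : ℝ} {U : Set (Eucl n)}
    {f g : Eucl n → F} (hf : MemLpLoc p U f) (hg : MemLpLoc p U g) :
    MemLpLoc p U fun x => f x - g x :=
  fun K hK hKU => (hf K hK hKU).sub (hg K hK hKU)

lemma memLpLoc_of_continuousOn {F : Type*} [NormedAddCommGroup F] [SecondCountableTopology F]
    (p : ℝ) {U : Set (Eucl n)} {f : Eucl n → F} (hf : ContinuousOn f U) : MemLpLoc p U f := by
  intro K hK hKU
  have : IsFiniteMeasure (volume.restrict K) := ⟨by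
    rw [Measure.restrict_apply_univ]; exact hK.measure_lt_top⟩
  obtain ⟨B, hB⟩ := hK.exists_bound_of_continuousOn (hf.mono hKU)
  have hKm : MeasurableSet K := hK.isClosed.measurableSet
  exact MemLp.of_bound ((hf.mono hKU).aestronglyMeasurable hKm) B
    ((ae_restrict_iff' hKm).2 (Eventually.of_forall hB))

/-- This follows from |flux| = |G|^{p-1} and q = p/(p-1). -/
lemma MemLpLoc.flux {p q : ℝ} (hpq : q.HolderConjugate p) {U : Set (Eucl n)}
    {G : Eucl n → Eucl n} (hG : MemLpLoc p U G) : MemLpLoc q U fun x => flux p (G x) := by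
  have hp : 1 < p := hpq.symm.lt
  intro K hK hKU
  have h := (hG K hK hKU).norm_rpow_div (ENNReal.ofReal (p - 1))
  rw [ENNReal.toReal_ofReal (by linarith), ← ENNReal.ofReal_div_of_pos (by linarith),
    ← hpq.symm.conjugate_eq] at h
  refine h.of_le ((measurable_flux p).comp_aemeasurable
    (hG K hK hKU).1.aemeasurable).aestronglyMeasurable (Eventually.of_forall fun x => ?_)
  rw [norm_flux hp]
  exact le_abs_self _

lemma integrableOn_inner_gradient {q : ℝ} (hq : 1 ≤ q) {U : Set (Eucl n)} {V : Eucl n → Eucl n}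
    (hV : MemLpLoc q U V) {ζ : Eucl n → ℝ} (hζ : IsTestFunction U ζ) :
    Integrable fun x => inner ℝ (V x) (∇ ζ x) := by
  set S := tsupport ζ with hS
  have hSm : MeasurableSet S := (isClosed_tsupport ζ).measurableSet
  have hfin : IsFiniteMeasure (volume.restrict S) := ⟨by
    rw [Measure.restrict_apply_univ]; exact hζ.2.1.isCompact.measure_lt_top⟩
  have h1 : IntegrableOn V S := (hV S hζ.2.1 hζ.2.2).integrable (by simpa using hq)
  obtain ⟨C, hC⟩ := hζ.hasCompactSupport_gradient.exists_bound_of_continuous hζ.continuous_gradient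
  have h2 : IntegrableOn (fun x => inner ℝ (V x) (∇ ζ x)) S := by
    refine Integrable.mono' (h1.norm.mul_const C)
      (h1.1.inner hζ.continuous_gradient.aestronglyMeasurable) (Eventually.of_forall fun x => ?_)
    exact (norm_inner_le_norm _ _).trans (mul_le_mul_of_nonneg_left (hC x) (norm_nonneg _))
  refine h2.integrable_of_forall_notMem_eq_zero fun x hx => ?_
  rw [gradient_eq_zero_of_notMem_tsupport hx, inner_zero_right]

lemma integrableOn_smul_test {q : ℝ} (hq : 1 ≤ q) {U : Set (Eucl n)} {V : Eucl n → Eucl n}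
    (hV : MemLpLoc q U V) {ζ : Eucl n → ℝ} (hζ : IsTestFunction U ζ) :
    Integrable fun x => ζ x • V x := by
  set S := tsupport ζ with hS
  have hfin : IsFiniteMeasure (volume.restrict S) := ⟨by
    rw [Measure.restrict_apply_univ]; exact hζ.2.1.isCompact.measure_lt_top⟩
  have h1 : IntegrableOn V S := (hV S hζ.2.1 hζ.2.2).integrable (by simpa using hq)
  obtain ⟨C, hC⟩ := hζ.2.1.exists_bound_of_continuous hζ.1.continuous
  have h2 : IntegrableOn (fun x => ζ x • V x) S :=
    h1.bdd_smul C hζ.1.continuous.aestronglyMeasurable (Eventually.of_forall hC)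
  refine h2.integrable_of_forall_notMem_eq_zero fun x hx => ?_
  rw [image_eq_zero_of_notMem_tsupport hx, zero_smul]

lemma IsW1pLocWithGradient.mono {p : ℝ} {U V : Set (Eucl n)} {u : Eucl n → ℝ}
    {G : Eucl n → Eucl n} (h : IsW1pLocWithGradient p V u G) (hUV : U ⊆ V) :
    IsW1pLocWithGradient p U u G := by
  refine ⟨h.1.mono hUV, h.2.1.mono hUV, fun ζ hζ => ?_⟩
  have h1 := h.2.2 ζ (hζ.mono hUV)
  have e1 : ∀ x, x ∉ tsupport ζ → u x • ∇ ζ x = 0 := fun x hx => by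
    rw [gradient_eq_zero_of_notMem_tsupport hx, smul_zero]
  have e2 : ∀ x, x ∉ tsupport ζ → ζ x • G x = 0 := fun x hx => by
    rw [image_eq_zero_of_notMem_tsupport hx, zero_smul]
  rwa [setIntegral_eq_integral_of_tsupport e1 (hζ.2.2.trans hUV),
    setIntegral_eq_integral_of_tsupport e2 (hζ.2.2.trans hUV),
    ← setIntegral_eq_integral_of_tsupport e1 hζ.2.2,
    ← setIntegral_eq_integral_of_tsupport e2 hζ.2.2] at h1

lemma setIntegral_inner_gradient_mono {U V : Set (Eucl n)} (hUV : U ⊆ V) {W : Eucl n → Eucl n}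
    {ζ : Eucl n → ℝ} (hζ : IsTestFunction U ζ) :
    ∫ x in U, inner ℝ (W x) (∇ ζ x) = ∫ x in V, inner ℝ (W x) (∇ ζ x) := by
  have e : ∀ x, x ∉ tsupport ζ → inner ℝ (W x) (∇ ζ x) = 0 := fun x hx => by
    rw [gradient_eq_zero_of_notMem_tsupport hx, inner_zero_right]
  rw [setIntegral_eq_integral_of_tsupport e hζ.2.2,
    setIntegral_eq_integral_of_tsupport e (hζ.2.2.trans hUV)]

lemma IsWeaklyPSuperharmonic.mono {p : ℝ} {U V : Set (Eucl n)} {G : Eucl n → Eucl n}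
    (h : IsWeaklyPSuperharmonic p V G) (hUV : U ⊆ V) : IsWeaklyPSuperharmonic p U G :=
  fun ζ hζ hζ0 => by
    rw [setIntegral_inner_gradient_mono hUV hζ]; exact h ζ (hζ.mono hUV) hζ0

lemma IsWeaklyPHarmonic.mono {p : ℝ} {U V : Set (Eucl n)} {G : Eucl n → Eucl n}
    (h : IsWeaklyPHarmonic p V G) (hUV : U ⊆ V) : IsWeaklyPHarmonic p U G :=
  fun ζ hζ => by
    rw [setIntegral_inner_gradient_mono hUV hζ]; exact h ζ (hζ.mono hUV)

lemma isW1pLocWithGradient_of_contDiffOn (p : ℝ) {U : Set (Eucl n)} {ψ : Eucl n → ℝ}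
    (hU : IsOpen U) (hψ : ContDiffOn ℝ 2 ψ U) : IsW1pLocWithGradient p U ψ (∇ ψ) :=
  ⟨memLpLoc_of_continuousOn p hψ.continuousOn,
    memLpLoc_of_continuousOn p (continuousOn_gradient hU hψ),
    fun _ hζ => integral_smul_gradient_test hU (hψ.of_le one_le_two) hζ⟩

/-- Comparison of a weak subsolution `v₁` with a weak supersolution `v₂` of the `p`-Laplace
equation, when `{v₁ - v₂ ≥ k}` is compactly contained in `U`. -/
theorem comparison_principle (hn : 0 < n) {p : ℝ} (hp : 1 < p) {U K : Set (Eucl n)}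
    (hU : IsOpen U) (hK : IsCompact K) (hKU : K ⊆ U) {v₁ v₂ : Eucl n → ℝ}
    {G₁ G₂ : Eucl n → Eucl n} (hc₁ : ContinuousOn v₁ U) (hc₂ : ContinuousOn v₂ U)
    (h₁ : IsW1pLocWithGradient p U v₁ G₁) (h₂ : IsW1pLocWithGradient p U v₂ G₂)
    (hle : ∀ ζ, IsTestFunction U ζ → (∀ x, 0 ≤ ζ x) →
      ∫ x in U, inner ℝ (flux p (G₁ x)) (∇ ζ x) ≤ ∫ x in U, inner ℝ (flux p (G₂ x)) (∇ ζ x))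
    {k : ℝ} (hk : 0 < k) (hvK : ∀ x ∈ U, k ≤ v₁ x - v₂ x → x ∈ K) :
    ∀ x ∈ U, v₁ x - v₂ x ≤ k := by
  have hpq : (p / (p - 1)).HolderConjugate p := (Real.HolderConjugate.conjExponent hp).symm
  have hq : 1 ≤ p / (p - 1) := hpq.lt.le
  refine weak_comparison hn hpq hU hK hKU (f := fun x => v₁ x - v₂ x)
    (F := fun x => G₁ x - G₂ x) (H := fun x => flux p (G₁ x) - flux p (G₂ x)) (hc₁.sub hc₂)
    (h₁.2.1.sub h₂.2.1) ?_ ((h₁.2.1.flux hpq).sub (h₂.2.1.flux hpq)) ?_ ?_ hk hvK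
  · intro ζ hζ
    have i : ∀ {v : Eucl n → ℝ}, ContinuousOn v U → Integrable fun x => v x • ∇ ζ x :=
      fun hv => hζ.integrable_of_eq_zero hU (hv.smul hζ.continuous_gradient.continuousOn)
        fun x hx => by rw [gradient_eq_zero_of_notMem_tsupport hx, smul_zero]
    simp_rw [sub_smul, smul_sub]
    rw [integral_sub (i hc₁).integrableOn (i hc₂).integrableOn,
      integral_sub (integrableOn_smul_test hp.le h₁.2.1 hζ).integrableOn
        (integrableOn_smul_test hp.le h₂.2.1 hζ).integrableOn, h₁.2.2 ζ hζ, h₂.2.2 ζ hζ]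
    abel
  · intro x hx
    exact inner_flux_sub_pos hp (sub_ne_zero.1 hx)
  · intro ζ hζ hζ0
    simp_rw [inner_sub_left]
    rw [integral_sub (integrableOn_inner_gradient hq (h₁.2.1.flux hpq) hζ).integrableOn
      (integrableOn_inner_gradient hq (h₂.2.1.flux hpq) hζ).integrableOn]
    linarith [hle ζ hζ hζ0]

end FluxComparison

/-! ### Radial barrier and the strong minimum principle -/

section StrongMinimum

/-- The radial barrier `-a exp (-α |x - y|²)`. -/
def barrier (a α : ℝ) (y x : Eucl n) : ℝ := -a * Real.exp (-α * ‖x - y‖ ^ 2)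

lemma contDiff_barrier (a α : ℝ) (y : Eucl n) : ContDiff ℝ 2 (barrier a α y) := by
  unfold barrier
  exact contDiff_const.mul ((contDiff_const.mul
    ((contDiff_id.sub contDiff_const).norm_sq ℝ)).exp)

lemma hasFDerivAt_norm_sub_sq (y x : Eucl n) :
    HasFDerivAt (fun z => ‖z - y‖ ^ 2) ((2 : ℝ) • innerSL ℝ (x - y)) x := by
  have h : HasFDerivAt (fun z : Eucl n => z - y) (ContinuousLinearMap.id ℝ (Eucl n)) x :=
    (hasFDerivAt_id x).sub_const y
  have h2 := h.norm_sq
  rw [two_nsmul, ← two_smul ℝ] at h2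
  exact h2

lemma hasFDerivAt_exp_barrier (α : ℝ) (y x : Eucl n) :
    HasFDerivAt (fun z => Real.exp (-α * ‖z - y‖ ^ 2))
      ((-2 * α * Real.exp (-α * ‖x - y‖ ^ 2)) • innerSL ℝ (x - y)) x := by
  have h := ((hasFDerivAt_norm_sub_sq y x).const_mul (-α)).exp
  have e : (-2 * α * Real.exp (-α * ‖x - y‖ ^ 2)) • innerSL ℝ (x - y) =
      Real.exp (-α * ‖x - y‖ ^ 2) • -α • (2 : ℝ) • innerSL ℝ (x - y) := by
    rw [smul_smul, smul_smul]
    congr 1; ring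
  rw [e]
  exact h

lemma gradient_barrier (a α : ℝ) (y x : Eucl n) :
    ∇ (barrier a α y) x = (2 * a * α * Real.exp (-α * ‖x - y‖ ^ 2)) • (x - y) := by
  have h : HasFDerivAt (barrier a α y)
      ((-a) • ((-2 * α * Real.exp (-α * ‖x - y‖ ^ 2)) • innerSL ℝ (x - y))) x :=
    (hasFDerivAt_exp_barrier α y x).const_mul (-a)
  refine ext_inner_right ℝ fun v => ?_
  rw [inner_gradient_left, h.fderiv, real_inner_smul_left]
  simp only [smul_apply, innerSL_apply_apply, smul_eq_mul]
  ring

lemma hessian_barrier (a α : ℝ) (y x : Eucl n) :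
    hessian (barrier a α y) x = (2 * a * α * Real.exp (-α * ‖x - y‖ ^ 2)) •
      (ContinuousLinearMap.id ℝ (Eucl n) -
        (2 * α) • (innerSL ℝ (x - y)).smulRight (x - y)) := by
  have hg : ∇ (barrier a α y) = fun z =>
      (2 * a * α * Real.exp (-α * ‖z - y‖ ^ 2)) • (z - y) := funext (gradient_barrier a α y)
  have h1 : HasFDerivAt (fun z : Eucl n => z - y) (ContinuousLinearMap.id ℝ (Eucl n)) x :=
    (hasFDerivAt_id x).sub_const y
  have h2 : HasFDerivAt (fun z => (2 * a * α * Real.exp (-α * ‖z - y‖ ^ 2)) • (z - y))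
      ((2 * a * α * Real.exp (-α * ‖x - y‖ ^ 2)) • ContinuousLinearMap.id ℝ (Eucl n) +
        ((2 * a * α) • (-2 * α * Real.exp (-α * ‖x - y‖ ^ 2)) • innerSL ℝ (x - y)).smulRight
          (x - y)) x :=
    ((hasFDerivAt_exp_barrier α y x).const_mul (2 * a * α)).smul h1
  rw [hessian, hg, h2.fderiv]
  ext v i
  simp only [add_apply, smul_apply, sub_apply, ContinuousLinearMap.id_apply,
    ContinuousLinearMap.smulRight_apply, innerSL_apply_apply, PiLp.add_apply, PiLp.smul_apply,
    PiLp.sub_apply, smul_eq_mul]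
  ring

lemma coordTrace_hessian_barrier (a α : ℝ) (y x : Eucl n) :
    coordTrace (hessian (barrier a α y) x) =
      2 * a * α * Real.exp (-α * ‖x - y‖ ^ 2) * (n - 2 * α * ‖x - y‖ ^ 2) := by
  have h : ∑ i : Fin n, (x - y) i * (x - y) i = ‖x - y‖ ^ 2 := by
    rw [EuclideanSpace.norm_sq_eq]
    exact Finset.sum_congr rfl fun i _ => by rw [Real.norm_eq_abs, sq_abs, sq]
  have h1 : ∀ i : Fin n, (hessian (barrier a α y) x (EuclideanSpace.single i 1)) i =
      2 * a * α * Real.exp (-α * ‖x - y‖ ^ 2) * (1 - 2 * α * ((x - y) i * (x - y) i)) := by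
    intro i
    rw [hessian_barrier]
    simp [EuclideanSpace.inner_single_right]
  rw [coordTrace, Finset.sum_congr rfl fun i _ => h1 i, ← Finset.mul_sum,
    Finset.sum_sub_distrib, ← Finset.mul_sum, h]
  simp

lemma normalizedForm_barrier (p a α : ℝ) (y x : Eucl n) :
    normalizedForm p (hessian (barrier a α y) x) (∇ (barrier a α y) x) =
      (2 * a * α * Real.exp (-α * ‖x - y‖ ^ 2)) ^ 3 * ‖x - y‖ ^ 2 *
        (n + p - 2 - 2 * α * (p - 1) * ‖x - y‖ ^ 2) := by
  have h : inner ℝ (hessian (barrier a α y) x (x - y)) (x - y) =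
      2 * a * α * Real.exp (-α * ‖x - y‖ ^ 2) *
        (‖x - y‖ ^ 2 - 2 * α * (‖x - y‖ ^ 2 * ‖x - y‖ ^ 2)) := by
    rw [hessian_barrier]
    simp only [smul_apply, sub_apply, ContinuousLinearMap.id_apply,
      ContinuousLinearMap.smulRight_apply, innerSL_apply_apply, real_inner_smul_left,
      inner_sub_left (𝕜 := ℝ) (_ - _), real_inner_self_eq_norm_sq]
  rw [gradient_barrier, normalizedForm_smul, normalizedForm, h, coordTrace_hessian_barrier]
  ring

/-- The choice of α makes both α|x - y|² and α(p - 1)|x - y|² at least n + p outside B_ρ(y). The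
form at the gradient and the trace are then both nonpositive, so every δ is admissible. -/
lemma isWeaklyPSuperharmonic_barrier {p : ℝ} (hp : 1 < p) {a α ρ : ℝ} (ha : 0 < a) (hρ : 0 < ρ)
    (hα : α = (n + p) * (1 + 1 / (p - 1)) / ρ ^ 2) {y : Eucl n} {U : Set (Eucl n)}
    (hU : IsOpen U) (h : ∀ x ∈ U, ρ ≤ ‖x - y‖) :
    IsWeaklyPSuperharmonic p U (∇ (barrier a α y)) := by
  have hp1 : 0 < p - 1 := by linarith
  have hn : (0:ℝ) ≤ n := n.cast_nonneg
  have hα0 : 0 < α := by rw [hα]; positivity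
  refine isWeaklyPSuperharmonic_gradient hp hU (contDiff_barrier a α y).contDiffOn one_pos ?_
  intro x hx δ hδ
  rw [normalizedForm_barrier, coordTrace_hessian_barrier]
  have hX : (n + p) * (1 + 1 / (p - 1)) ≤ α * ‖x - y‖ ^ 2 := by
    have h1 : (n + p) * (1 + 1 / (p - 1)) = α * ρ ^ 2 := by rw [hα]; field_simp
    rw [h1]
    have := h x hx
    gcongr
  have h1 : (n : ℝ) + p ≤ α * ‖x - y‖ ^ 2 := by
    refine le_trans ?_ hX
    refine le_mul_of_one_le_right (by linarith) ?_
    have : 0 < 1 / (p - 1) := by positivity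
    linarith
  have h2 : (n : ℝ) + p ≤ α * (p - 1) * ‖x - y‖ ^ 2 := by
    have h3 : (n + p) * (1 + 1 / (p - 1)) * (p - 1) ≤ α * ‖x - y‖ ^ 2 * (p - 1) := by gcongr
    have h4 : (n + p) * (1 + 1 / (p - 1)) * (p - 1) = (n + p) * p := by field_simp; ring
    have h5 : (n : ℝ) + p ≤ (n + p) * p := le_mul_of_one_le_right (by linarith) hp.le
    linarith
  have e : 0 < 2 * a * α * Real.exp (-α * ‖x - y‖ ^ 2) := by positivity
  have t1 : (2 * a * α * Real.exp (-α * ‖x - y‖ ^ 2)) ^ 3 * ‖x - y‖ ^ 2 *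
      (n + p - 2 - 2 * α * (p - 1) * ‖x - y‖ ^ 2) ≤ 0 :=
    mul_nonpos_of_nonneg_of_nonpos (by positivity) (by linarith)
  have t2 : 2 * a * α * Real.exp (-α * ‖x - y‖ ^ 2) * (n - 2 * α * ‖x - y‖ ^ 2) ≤ 0 :=
    mul_nonpos_of_nonneg_of_nonpos e.le (by linarith)
  have t3 := mul_nonpos_of_nonneg_of_nonpos hδ.1.le t2
  linarith

lemma gradient_const_sub (c : ℝ) {f : Eucl n → ℝ} {x : Eucl n} :
    ∇ (fun y => c - f y) x = -∇ f x := by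
  refine ext_inner_right ℝ fun v => ?_
  rw [inner_gradient_left, inner_neg_left, inner_gradient_left, fderiv_const_sub]
  rfl

/-- **Strong minimum principle**: a weakly `p`-superharmonic function which attains its minimum at
the center of a ball is constant in a smaller ball. -/
theorem strong_minimum_principle (hn : 0 < n) {p : ℝ} (hp : 1 < p) {x₀ : Eucl n} {s m : ℝ}
    (hs : 0 < s) {u : Eucl n → ℝ} {G : Eucl n → Eucl n}
    (hu : ContinuousOn u (Metric.ball x₀ s)) (hm : ∀ x ∈ Metric.ball x₀ s, m ≤ u x)
    (hx₀ : u x₀ = m) (hW : IsW1pLocWithGradient p (Metric.ball x₀ s) u G)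
    (hG : IsWeaklyPSuperharmonic p (Metric.ball x₀ s) G) :
    ∀ x ∈ Metric.ball x₀ (s / 4), u x = m := by
  by_contra! hcon
  obtain ⟨x₁, hx₁, hne⟩ := hcon
  rw [Metric.mem_ball] at hx₁
  have hsub : Metric.closedBall x₀ (s / 2) ⊆ Metric.ball x₀ s :=
    Metric.closedBall_subset_ball (by linarith)
  have hcl : ContinuousOn u (Metric.closedBall x₀ (s / 2)) := hu.mono hsub
  set Z : Set (Eucl n) := Metric.closedBall x₀ (s / 2) ∩ u ⁻¹' {m} with hZ
  have hZc : IsCompact Z :=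
    (isCompact_closedBall x₀ (s / 2)).of_isClosed_subset
      (hcl.preimage_isClosed_of_isClosed Metric.isClosed_closedBall isClosed_singleton)
      inter_subset_left
  have hZne : Z.Nonempty := ⟨x₀, Metric.mem_closedBall_self (by linarith), hx₀⟩
  -- The point z is a point of {u = m} nearest to x₁, so u > m in the open ball B_d(x₁), which has z
  -- on its boundary.
  obtain ⟨z, hzZ, hzmin⟩ := hZc.exists_isMinOn hZne
    (continuous_id.dist (continuous_const (y := x₁))).continuousOn
  have hzmin' : ∀ y ∈ Z, dist z x₁ ≤ dist y x₁ := fun y hy => hzmin hy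
  set d := dist z x₁ with hd
  have hd4 : d < s / 4 := by
    refine (hzmin' x₀ ⟨Metric.mem_closedBall_self (by linarith), hx₀⟩).trans_lt ?_
    rwa [dist_comm]
  have hzx₁ : z ≠ x₁ := by
    rintro rfl
    exact hne hzZ.2
  have hd0 : 0 < d := dist_pos.2 hzx₁
  have hball : ∀ y, dist y x₁ < d → m < u y := by
    intro y hy
    have hy0 : y ∈ Metric.closedBall x₀ (s / 2) := by
      rw [Metric.mem_closedBall]
      have := dist_triangle y x₁ x₀
      linarith
    refine lt_of_le_of_ne (hm y (hsub hy0)) fun h => ?_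
    have := hzmin' y ⟨hy0, h.symm⟩
    linarith
  set ρ := d / 2 with hρ
  have hρ0 : 0 < ρ := by positivity
  -- The half-size ball centered at the midpoint of z and x₁ is internally tangent at z, so its
  -- closure meets {u = m} only at z.
  set b : Eucl n := (1 / 2 : ℝ) • (x₁ - z) with hb
  set x₂ : Eucl n := z + b with hx₂
  have hbn : ‖b‖ = ρ := by
    rw [hb, norm_smul, ← dist_eq_norm, dist_comm, ← hd, Real.norm_eq_abs,
      abs_of_pos (by norm_num : (0:ℝ) < 1 / 2), hρ]
    ring
  have hx₁b : x₁ = x₂ + b := by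
    rw [hx₂, hb, add_assoc, ← add_smul]; norm_num
  have hzx₂ : ‖z - x₂‖ = ρ := by
    rw [hx₂, sub_add_cancel_left, norm_neg, hbn]
  have hin : ∀ y, ‖y - x₂‖ ≤ ρ → y ≠ z → m < u y := by
    intro y hy hyz
    refine hball y ?_
    have h1 : y - x₁ = (y - x₂) - b := by rw [hx₁b]; abel
    have h2 : y - z = (y - x₂) + b := by rw [hx₂]; abel
    have h3 : 0 < ‖(y - x₂) + b‖ := by rw [← h2]; exact norm_pos_iff.2 (sub_ne_zero.2 hyz)
    have h4 := parallelogram_law_with_norm ℝ (y - x₂) b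
    rw [dist_eq_norm, h1]
    rw [hbn] at h4
    have h5 : ‖y - x₂ - b‖ ^ 2 < d ^ 2 := by
      have h6 : ‖y - x₂‖ * ‖y - x₂‖ ≤ ρ * ρ := by gcongr
      have h7 : d ^ 2 = 4 * (ρ * ρ) := by rw [hρ]; ring
      nlinarith
    exact lt_of_pow_lt_pow_left₀ 2 hd0.le h5
  -- The closed δ-ball around z stays at distance at least δ from the barrier's center x₂.
  set δ := ρ / 2 with hδ
  have hδ0 : 0 < δ := by positivity
  have hδs : Metric.closedBall z δ ⊆ Metric.ball x₀ s := by
    intro y hy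
    rw [Metric.mem_closedBall] at hy
    have h1 := hzZ.1
    rw [Metric.mem_closedBall] at h1
    rw [Metric.mem_ball]
    have := dist_triangle y z x₀
    linarith
  have hfar : ∀ y ∈ Metric.closedBall z δ, δ ≤ ‖y - x₂‖ := by
    intro y hy
    rw [Metric.mem_closedBall, dist_eq_norm] at hy
    have h1 : ‖z - x₂‖ ≤ ‖y - x₂‖ + ‖y - z‖ := by
      have : z - x₂ = (y - x₂) - (y - z) := by abel
      rw [this]; exact norm_sub_le _ _
    linarith
  set α : ℝ := (n + p) * (1 + 1 / (p - 1)) / δ ^ 2 with hα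
  have hα0 : 0 < α := by
    have : 0 < p - 1 := by linarith
    have hn' : (0:ℝ) ≤ n := n.cast_nonneg
    rw [hα]; positivity
  set E : Eucl n → ℝ := fun x => Real.exp (-α * ‖x - x₂‖ ^ 2) with hE
  set E₀ : ℝ := Real.exp (-α * ρ ^ 2) with hE₀
  have hEc : Continuous E := by fun_prop
  have hS : IsCompact (Metric.sphere z δ) := isCompact_sphere z δ
  have hSsub : Metric.sphere z δ ⊆ Metric.closedBall z δ := Metric.sphere_subset_closedBall
  -- Outside the tangent ball the exponential lies below its value at z; inside it u > m.
  -- Compactness of the sphere gives a uniform margin.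
  obtain ⟨θ, hθ0, hθ⟩ : ∃ θ > 0, ∀ y ∈ Metric.sphere z δ, θ ≤ max (E₀ - E y) (u y - m) := by
    refine hS.exists_forall_le' (f := fun y => max (E₀ - E y) (u y - m)) ?_ ?_
    · have h1 : ContinuousOn (fun y => E₀ - E y) (Metric.sphere z δ) :=
        continuousOn_const.sub hEc.continuousOn
      have h2 : ContinuousOn (fun y => u y - m) (Metric.sphere z δ) :=
        (hu.mono (hSsub.trans hδs)).sub continuousOn_const
      exact ContinuousOn.sup h1 h2
    · intro y hy
      by_cases h : ‖y - x₂‖ ≤ ρ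
      · refine lt_max_of_lt_right (sub_pos.2 (hin y h ?_))
        rintro rfl
        rw [Metric.mem_sphere, dist_self] at hy
        linarith
      · refine lt_max_of_lt_left (sub_pos.2 ?_)
        push Not at h
        refine Real.exp_lt_exp.2 ?_
        have : ρ ^ 2 < ‖y - x₂‖ ^ 2 := by gcongr
        nlinarith
  -- The amplitude is small enough that v stays below u where u ≥ m + θ. Elsewhere on the sphere the
  -- drop aθ of the barrier outweighs the lift aθ/2 in `c`. At z that lift gives v - u = aθ/2, above
  -- the comparison level k = aθ/4.
  set a : ℝ := θ / (2 * (1 + θ)) with ha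
  have ha0 : 0 < a := by positivity
  have haθ : a * (1 + θ) = θ / 2 := by rw [ha]; field_simp
  set c : ℝ := m - a * E₀ + a * θ / 2 with hc
  set v : Eucl n → ℝ := fun x => c - barrier a α x₂ x with hv
  have hvE : ∀ x, v x = m + a * (E x - E₀) + a * θ / 2 := by
    intro x
    simp only [hv, hc, barrier, hE]
    ring
  have hvs : ContDiff ℝ 2 v := contDiff_const.sub (contDiff_barrier a α x₂)
  have hgv : ∇ v = fun x => -∇ (barrier a α x₂) x := funext fun x => gradient_const_sub c
  have hUsub : Metric.ball z δ ⊆ Metric.ball x₀ s := Metric.ball_subset_closedBall.trans hδs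
  have hbar := isWeaklyPSuperharmonic_barrier hp ha0 hδ0 hα Metric.isOpen_ball
    (fun x (hx : x ∈ Metric.ball z δ) => hfar x (Metric.ball_subset_closedBall hx))
  set k : ℝ := a * θ / 4 with hk
  have hk0 : 0 < k := by positivity
  set K : Set (Eucl n) := Metric.closedBall z δ ∩ (fun x => v x - u x) ⁻¹' Ici k with hK
  have hfc : ContinuousOn (fun x => v x - u x) (Metric.closedBall z δ) :=
    hvs.continuous.continuousOn.sub (hu.mono hδs)
  have hKc : IsCompact K := (isCompact_closedBall z δ).of_isClosed_subset
    (hfc.preimage_isClosed_of_isClosed Metric.isClosed_closedBall isClosed_Ici) inter_subset_left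
  have hKU : K ⊆ Metric.ball z δ := by
    rintro x ⟨hx, hxk⟩
    rw [Metric.mem_closedBall] at hx
    rw [Metric.mem_ball]
    refine lt_of_le_of_ne hx fun h => ?_
    have hxk' : k ≤ v x - u x := hxk
    rw [hvE] at hxk'
    have hxu := hm x (hδs hx)
    have hE1 : E x ≤ 1 := Real.exp_le_one_iff.2 (by
      have : 0 ≤ α * ‖x - x₂‖ ^ 2 := by positivity
      linarith)
    have hE0 : 0 < E₀ := Real.exp_pos _
    rcases le_max_iff.1 (hθ x h) with h1 | h1
    · have : a * (E x - E₀) ≤ a * (-θ) := by gcongr; linarith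
      have : 0 < a * θ := by positivity
      linarith
    · have h2 : a * (E x - E₀) ≤ a * 1 := by gcongr; linarith
      have h3 : 0 < a * θ := by positivity
      linarith
  have hcomp := comparison_principle hn hp Metric.isOpen_ball hKc hKU
    (v₁ := v) (v₂ := u) (G₁ := ∇ v) (G₂ := G) hvs.continuous.continuousOn (hu.mono hUsub)
    (isW1pLocWithGradient_of_contDiffOn p Metric.isOpen_ball hvs.contDiffOn) (hW.mono hUsub)
    (fun ζ hζ hζ0 => by
      have h1 := hbar ζ hζ hζ0
      have h2 := (hG.mono hUsub) ζ hζ hζ0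
      have h3 : ∫ x in Metric.ball z δ, inner ℝ (flux p (∇ v x)) (∇ ζ x) =
          -∫ x in Metric.ball z δ, inner ℝ (flux p (∇ (barrier a α x₂) x)) (∇ ζ x) := by
        rw [← integral_neg]
        simp only [hgv, flux_neg, inner_neg_left]
      linarith)
    hk0 (fun x hx hxk => ⟨Metric.ball_subset_closedBall hx, hxk⟩) z (Metric.mem_ball_self hδ0)
  have hEz : E z = E₀ := by simp only [hE, hE₀, hzx₂]
  have huz : u z = m := hzZ.2
  have hvz : v z - u z = a * θ / 2 := by rw [hvE, hEz, huz]; ring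
  rw [hvz, hk] at hcomp
  have : 0 < a * θ := by positivity
  linarith

end StrongMinimum

/-! ### Adding a small quadratic to the obstacle -/

section Quadratic

lemma gradient_add_quadratic {φ : Eucl n → ℝ} {x : Eucl n} (a : ℝ) (y : Eucl n)
    (h : DifferentiableAt ℝ φ x) :
    ∇ (fun z => φ z + a * ‖z - y‖ ^ 2) x = ∇ φ x + (2 * a) • (x - y) := by
  have h1 : HasFDerivAt (fun z => φ z + a * ‖z - y‖ ^ 2)
      (fderiv ℝ φ x + a • (2 : ℝ) • innerSL ℝ (x - y)) x :=
    h.hasFDerivAt.add ((hasFDerivAt_norm_sub_sq y x).const_mul a)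
  refine ext_inner_right ℝ fun v => ?_
  rw [inner_gradient_left, h1.fderiv, inner_add_left, inner_gradient_left, real_inner_smul_left]
  simp only [add_apply, smul_apply, innerSL_apply_apply, smul_eq_mul]
  ring

lemma hessian_add_quadratic {U : Set (Eucl n)} (hU : IsOpen U) {φ : Eucl n → ℝ}
    (hφ : ContDiffOn ℝ 2 φ U) {x : Eucl n} (hx : x ∈ U) (a : ℝ) (y : Eucl n) :
    hessian (fun z => φ z + a * ‖z - y‖ ^ 2) x =
      hessian φ x + (2 * a) • ContinuousLinearMap.id ℝ (Eucl n) := by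
  have h1 : ∇ (fun z => φ z + a * ‖z - y‖ ^ 2) =ᶠ[𝓝 x] fun z => ∇ φ z + (2 * a) • (z - y) := by
    filter_upwards [hU.mem_nhds hx] with z hz
    exact gradient_add_quadratic a y
      ((hφ.contDiffAt (hU.mem_nhds hz)).differentiableAt (by norm_num))
  have h2 : HasFDerivAt (fun z : Eucl n => z - y) (ContinuousLinearMap.id ℝ (Eucl n)) x :=
    (hasFDerivAt_id x).sub_const y
  have h3 : HasFDerivAt (fun z => ∇ φ z + (2 * a) • (z - y))
      (hessian φ x + (2 * a) • ContinuousLinearMap.id ℝ (Eucl n)) x :=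
    (hasFDerivAt_gradient hU hφ hx).add (h2.const_smul (2 * a))
  rw [hessian, h1.fderiv_eq, h3.fderiv]

/-- Adding a small multiple of a quadratic polynomial preserves weak `p`-superharmonicity of a
function whose Hessian satisfies the strict inequality near its gradient. -/
lemma isWeaklyPSuperharmonic_add_quadratic {p : ℝ} (hp : 1 < p) {a c ε ρ M : ℝ}
    (ha : 0 ≤ a) (hc : 0 < c) (hε : 0 < ε) (hρ : 0 < ρ) (hac : 2 * a ≤ c / 8)
    (haε : 2 * a * (n + p - 2) ≤ ε / 2) {U : Set (Eucl n)} (hU : IsOpen U) {φ : Eucl n → ℝ}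
    (hφ : ContDiffOn ℝ 2 φ U) {y : Eucl n} (hy : Metric.ball y ρ ⊆ U)
    (hM : ∀ x ∈ Metric.ball y ρ, ‖hessian φ x‖ ≤ M)
    (h : ∀ x ∈ Metric.ball y ρ, ∀ q, ‖q - ∇ φ x‖ ≤ c * ρ →
      normalizedForm p (hessian φ x) q ≤ -ε * ‖q‖ ^ 2) :
    IsWeaklyPSuperharmonic p (Metric.ball y ρ) (∇ (fun z => φ z + a * ‖z - y‖ ^ 2)) := by
  set ψ : Eucl n → ℝ := fun z => φ z + a * ‖z - y‖ ^ 2 with hψ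
  have hψ2 : ContDiffOn ℝ 2 ψ (Metric.ball y ρ) :=
    (hφ.mono hy).add (contDiff_const.mul
      ((contDiff_id.sub contDiff_const).norm_sq ℝ)).contDiffOn
  have hM0 : 0 ≤ M := (norm_nonneg _).trans (hM y (Metric.mem_ball_self hρ))
  -- An upper bound for the trace of D²ψ; the added 1 keeps it positive as a denominator in δ₀.
  set T : ℝ := n * M + 2 * a * n + 1 with hT
  have hT0 : 0 < T := by positivity
  refine isWeaklyPSuperharmonic_gradient hp Metric.isOpen_ball hψ2
    (δ₀ := ε / 2 * (c * ρ / 8) ^ 2 / T) (by positivity) ?_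
  intro x hx δ hδ
  have hd : DifferentiableAt ℝ φ x :=
    (hφ.contDiffAt (hU.mem_nhds (hy hx))).differentiableAt (by norm_num)
  have hg : ∇ ψ x = ∇ φ x + (2 * a) • (x - y) := gradient_add_quadratic a y hd
  have hH : hessian ψ x = hessian φ x + (2 * a) • ContinuousLinearMap.id ℝ (Eucl n) :=
    hessian_add_quadratic hU hφ (hy hx) a y
  have hgd : ‖∇ ψ x - ∇ φ x‖ ≤ c * ρ / 8 := by
    rw [hg, add_sub_cancel_left, norm_smul, Real.norm_eq_abs, abs_of_nonneg (by positivity)]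
    have h1 : ‖x - y‖ ≤ ρ := by
      rw [← dist_eq_norm]; exact (Metric.mem_ball.1 hx).le
    calc 2 * a * ‖x - y‖ ≤ c / 8 * ρ := by gcongr
      _ = c * ρ / 8 := by ring
  have hcρ : 0 < c * ρ := by positivity
  have hform : ∀ q, ‖q - ∇ φ x‖ ≤ c * ρ →
      normalizedForm p (hessian ψ x) q ≤ -(ε / 2) * ‖q‖ ^ 2 := by
    intro q hq
    rw [hH, normalizedForm_add_smul_id]
    have h1 := h x hx q hq
    have h2 : 2 * a * (n + p - 2) * ‖q‖ ^ 2 ≤ ε / 2 * ‖q‖ ^ 2 := by gcongr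
    linarith
  have hself := hform (∇ ψ x) (by linarith)
  -- If ∇ψ is small, the ball of admissible q contains all vectors of length cρ/2. By homogeneity
  -- the form is nonpositive everywhere, hence so is the trace. If ∇ψ is large, the strict term
  -- (ε/2)|∇ψ|² absorbs δ tr D²ψ for δ < δ₀.
  by_cases hsmall : ‖∇ ψ x‖ ≤ c * ρ / 8
  · have hall : ∀ v, normalizedForm p (hessian ψ x) v ≤ 0 := by
      intro v
      by_cases hv : v = 0
      · rw [hv, show (0 : Eucl n) = (0 : ℝ) • (0 : Eucl n) by simp, normalizedForm_smul]
        simp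
      have hv0 : 0 < ‖v‖ := norm_pos_iff.2 hv
      set t : ℝ := c * ρ / 2 / ‖v‖ with ht
      have ht0 : 0 < t := by positivity
      have htv : ‖t • v‖ = c * ρ / 2 := by
        rw [norm_smul, Real.norm_eq_abs, abs_of_pos ht0, ht]; field_simp
      have h1 : ‖t • v - ∇ φ x‖ ≤ c * ρ := by
        have e : t • v - ∇ φ x = t • v - ∇ ψ x + (∇ ψ x - ∇ φ x) := by abel
        rw [e]
        have := norm_add_le (t • v - ∇ ψ x) (∇ ψ x - ∇ φ x)
        have := norm_sub_le (t • v) (∇ ψ x)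
        linarith
      have h2 := hform _ h1
      rw [normalizedForm_smul] at h2
      have h3 : t ^ 2 * normalizedForm p (hessian ψ x) v ≤ 0 :=
        h2.trans (by have : 0 ≤ ε / 2 * ‖t • v‖ ^ 2 := by positivity
                     linarith)
      exact nonpos_of_mul_nonpos_right h3 (by positivity)
    have h1 := coordTrace_nonpos_of_normalizedForm hp hall
    have h2 := mul_nonpos_of_nonneg_of_nonpos hδ.1.le h1
    have h3 := hall (∇ ψ x)
    linarith
  · push Not at hsmall
    have h1 : coordTrace (hessian ψ x) ≤ T := by
      rw [hH, coordTrace_add, coordTrace_smul_id]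
      have h2 := (le_abs_self _).trans (abs_coordTrace_le (hessian φ x))
      have h3 : (n : ℝ) * ‖hessian φ x‖ ≤ n * M := by gcongr; exact hM x hx
      linarith
    have h2 : δ * coordTrace (hessian ψ x) ≤ ε / 2 * (c * ρ / 8) ^ 2 := by
      calc δ * coordTrace (hessian ψ x) ≤ δ * T := by gcongr; exact hδ.1.le
        _ ≤ ε / 2 * (c * ρ / 8) ^ 2 / T * T := by gcongr; exact hδ.2.le
        _ = ε / 2 * (c * ρ / 8) ^ 2 := by field_simp
    have h3 : ε / 2 * (c * ρ / 8) ^ 2 ≤ ε / 2 * ‖∇ ψ x‖ ^ 2 := by gcongr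
    linarith

end Quadratic

/-! ### The two cases of the dichotomy -/

section Nondegeneracy

lemma isOpen_noncontactSet {Ω : Set (Eucl n)} (hΩ : IsOpen Ω) {φ u : Eucl n → ℝ}
    (hφ : ContinuousOn φ Ω) (hu : ContinuousOn u Ω) : IsOpen (noncontactSet Ω φ u) := by
  have h : ContinuousOn (fun x => u x - φ x) Ω := hu.sub hφ
  have e : noncontactSet Ω φ u = Ω ∩ (fun x => u x - φ x) ⁻¹' Ioi 0 := by
    ext x
    simp [noncontactSet]
  rw [e]
  exact h.isOpen_inter_preimage hΩ isOpen_Ioi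

/-- Where the gradient of the obstacle vanishes identically there is no free boundary. -/
lemma notMem_closure_noncontactSet_of_gradient_eq_zero (hn : 0 < n) {p : ℝ} (hp : 1 < p)
    {Ω : Set (Eucl n)} {φ u : Eucl n → ℝ} (hφ : ContDiffOn ℝ 2 φ Ω)
    (hsol : IsObstacleSolution p Ω φ u) {x₀ : Eucl n} {s : ℝ} (hs : 0 < s)
    (hsΩ : Metric.ball x₀ s ⊆ Ω) (hg : ∀ x ∈ Metric.ball x₀ s, ∇ φ x = 0) (hx₀ : u x₀ = φ x₀) :
    x₀ ∉ closure (noncontactSet Ω φ u) := by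
  obtain ⟨hu, hle, G, hW, hS, -⟩ := hsol
  have hconst : ∀ x ∈ Metric.ball x₀ s, φ x = φ x₀ := by
    intro x hx
    refine Metric.isOpen_ball.is_const_of_fderiv_eq_zero (𝕜 := ℝ)
      (convex_ball x₀ s).isPreconnected
      ((hφ.mono hsΩ).differentiableOn (by norm_num)) ?_ hx (Metric.mem_ball_self hs)
    intro y hy
    ext v
    rw [← inner_gradient_left, hg y hy, inner_zero_left]
    rfl
  have hmin := strong_minimum_principle hn hp hs (hu.mono hsΩ)
    (fun x hx => (hconst x hx).symm.le.trans (hle x (hsΩ hx))) hx₀ (hW.mono hsΩ) (hS.mono hsΩ)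
  intro hcl
  obtain ⟨y, hy, hyd⟩ := Metric.mem_closure_iff.1 hcl (s / 4) (by positivity)
  rw [dist_comm] at hyd
  have h1 := hmin y hyd
  have h2 := hconst y (Metric.mem_ball.2 (by linarith))
  have h3 : φ y < u y := hy.2
  linarith

/-- The nondegeneracy of the solution in a ball centered in the noncontact set. -/
lemma exists_quadratic_le_of_superharmonic (hn : 0 < n) {p : ℝ} (hp : 1 < p) {Ω : Set (Eucl n)}
    (hΩ : IsOpen Ω) {φ u : Eucl n → ℝ} (hφ : ContDiffOn ℝ 2 φ Ω)
    (hsol : IsObstacleSolution p Ω φ u) {x₁ : Eucl n} {a ρ : ℝ} (hρ : 0 < ρ)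
    (hx₁ : φ x₁ < u x₁) (hball : Metric.closedBall x₁ ρ ⊆ Ω)
    (hψ : IsWeaklyPSuperharmonic p (Metric.ball x₁ ρ) (∇ (fun z => φ z + a * ‖z - x₁‖ ^ 2))) :
    ∃ x ∈ Metric.closedBall x₁ ρ, a * ρ ^ 2 ≤ u x - φ x := by
  by_contra! hcon
  have hW0 := isOpen_noncontactSet hΩ hφ.continuousOn hsol.1
  obtain ⟨hu, hle, G, hW, -, hH⟩ := hsol
  set ψ : Eucl n → ℝ := fun z => φ z + a * ‖z - x₁‖ ^ 2 with hψdef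
  have hψ2 : ContDiffOn ℝ 2 ψ Ω :=
    hφ.add (contDiff_const.mul ((contDiff_id.sub contDiff_const).norm_sq ℝ)).contDiffOn
  set U : Set (Eucl n) := noncontactSet Ω φ u ∩ Metric.ball x₁ ρ with hUdef
  have hUo : IsOpen U := hW0.inter Metric.isOpen_ball
  have hUΩ : U ⊆ Ω := fun x hx => hx.1.1
  set k : ℝ := (u x₁ - φ x₁) / 2 with hk
  have hk0 : 0 < k := by rw [hk]; linarith
  set K : Set (Eucl n) := Metric.closedBall x₁ ρ ∩ (fun x => u x - ψ x) ⁻¹' Ici k with hK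
  have hfc : ContinuousOn (fun x => u x - ψ x) (Metric.closedBall x₁ ρ) :=
    (hu.mono hball).sub (hψ2.continuousOn.mono hball)
  have hKc : IsCompact K := (isCompact_closedBall x₁ ρ).of_isClosed_subset
    (hfc.preimage_isClosed_of_isClosed Metric.isClosed_closedBall isClosed_Ici) inter_subset_left
  -- The sign of a comes from the contrary assumption at the center: 0 < u(x₁) - φ(x₁) < aρ².
  have ha : 0 ≤ a := by
    have h1 := hcon x₁ (Metric.mem_closedBall_self hρ.le)
    have h2 : 0 < a * ρ ^ 2 := by linarith
    exact (pos_of_mul_pos_left h2 (by positivity)).le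
  -- Where u ≥ ψ + k there is no contact, since ψ ≥ φ. The sphere is excluded because the contrary
  -- assumption gives u < ψ there.
  have hKU : K ⊆ U := by
    rintro x ⟨hx, hxk⟩
    have hxk' : k ≤ u x - (φ x + a * ‖x - x₁‖ ^ 2) := hxk
    have h1 : 0 ≤ a * ‖x - x₁‖ ^ 2 := by positivity
    refine ⟨⟨hball hx, by linarith⟩, ?_⟩
    rw [Metric.mem_closedBall] at hx
    rw [Metric.mem_ball]
    refine lt_of_le_of_ne hx fun h => ?_
    have h2 := hcon x (Metric.mem_closedBall.2 hx)
    rw [← dist_eq_norm, h] at hxk'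
    linarith
  have hcomp := comparison_principle hn hp hUo hKc hKU (v₁ := u) (v₂ := ψ) (G₁ := G) (G₂ := ∇ ψ)
    (hu.mono hUΩ) (hψ2.continuousOn.mono hUΩ) (hW.mono hUΩ)
    (isW1pLocWithGradient_of_contDiffOn p hUo (hψ2.mono hUΩ))
    (fun ζ hζ hζ0 => by
      rw [(hH.mono inter_subset_left) ζ hζ]
      exact (hψ.mono inter_subset_right) ζ hζ hζ0)
    hk0 (fun x hx hxk => ⟨Metric.ball_subset_closedBall hx.2, hxk⟩) x₁
    ⟨⟨hball (Metric.mem_closedBall_self hρ.le), hx₁⟩, Metric.mem_ball_self hρ⟩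
  have h1 : u x₁ - ψ x₁ = 2 * k := by
    simp only [hψdef, hk, sub_self, norm_zero]
    ring
  rw [h1] at hcomp
  linarith

lemma IsModulusOfContinuity.exists_le {ω : ℝ → ℝ} (hω : IsModulusOfContinuity ω) {η : ℝ}
    (hη : 0 < η) : ∃ t₀ > 0, ∀ t, 0 ≤ t → t < t₀ → ω t ≤ η := by
  obtain ⟨t₀, ht₀, h⟩ := Metric.continuousWithinAt_iff.1 hω.2 η hη
  refine ⟨t₀, ht₀, fun t h0 ht => ?_⟩
  have h1 := h (x := t) h0 (by rw [Real.dist_eq, sub_zero, abs_of_nonneg h0]; exact ht)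
  rw [hω.1, Real.dist_eq, sub_zero] at h1
  exact (le_abs_self _).trans h1.le

end Nondegeneracy

end PObstacle

end

/-! ### The nondegeneracy theorem -/

theorem theorem1p2 (n : ℕ) (p : ℝ) (hp : 1 < p) (c₀ : ℝ) (hc₀ : 0 < c₀)
    (R : ℝ) (hR : 1 / 2 < R) (hR1 : R ≤ 1)
    (ω : ℝ → ℝ) (hω : PObstacle.IsModulusOfContinuity ω) :
    ∃ c₁ : ℝ, 0 < c₁ ∧
      ∀ φ u : PObstacle.Eucl n → ℝ,
        ContDiffOn ℝ 2 φ (Metric.ball 0 1) →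
        PObstacle.HessianHasModulusOn ω (Metric.ball 0 R) φ →
        PObstacle.ConcavityCondition p c₀ (Metric.ball 0 1) φ →
        PObstacle.IsObstacleSolution p (Metric.ball 0 1) φ u →
        ∀ x₀ ∈ frontier (PObstacle.noncontactSet (Metric.ball 0 1) φ u) ∩ Metric.ball 0 (1 / 2),
          ∀ r ∈ Set.Ioo (0 : ℝ) (1 / 2),
            c₁ * r ^ 2 ≤ sSup ((fun x => u x - φ x) '' Metric.ball x₀ r) := by
  open PObstacle in
  rcases Nat.eq_zero_or_pos n with rfl | hn
  -- In dimension 0 the space is discrete, so frontiers are empty.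
  · refine ⟨1, one_pos, fun φ u _ _ _ _ x₀ hx₀ => ?_⟩
    exact absurd hx₀.1 (by
      rw [(isClopen_discrete _).frontier_eq]
      exact notMem_empty x₀)
  obtain ⟨ε, hε, c, hc, η, hη, hform⟩ := exists_normalizedForm_le_near_gradient n p hp c₀ hc₀
  obtain ⟨t₀, ht₀, hωt⟩ := hω.exists_le hη
  -- With ρ = ρ₀r and |x₁ - x₀| < ρ, the three bounds give, in order: the closed ρ-ball of x₁ lies
  -- in B_r(x₀); B_{2ρ}(x₁) lies in B_R, as 1/2 + 3ρ < R; points of B_{2ρ}(x₁) are less than t₀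
  -- apart, so D²φ oscillates there by at most η.
  set ρ₀ : ℝ := min (min (1 / 4) ((R - 1 / 2) / 4)) (t₀ / 4) with hρ₀
  have hρ₀0 : 0 < ρ₀ := lt_min (lt_min (by norm_num) (by linarith)) (by linarith)
  have hρ₀1 : ρ₀ ≤ 1 / 4 := (min_le_left _ _).trans (min_le_left _ _)
  have hρ₀R : ρ₀ ≤ (R - 1 / 2) / 4 := (min_le_left _ _).trans (min_le_right _ _)
  have hρ₀t : ρ₀ ≤ t₀ / 4 := min_le_right _ _
  have hnp : 0 < (n : ℝ) + p - 1 := by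
    have : (0 : ℝ) ≤ n := n.cast_nonneg
    linarith
  set a : ℝ := min (c / 16) (ε / (4 * (n + p - 1))) with ha
  have ha0 : 0 < a := lt_min (by positivity) (by positivity)
  have hac : 2 * a ≤ c / 8 := by
    have : a ≤ c / 16 := min_le_left _ _
    linarith
  have haε : 2 * a * (n + p - 2) ≤ ε / 2 := by
    have h1 : a ≤ ε / (4 * (n + p - 1)) := min_le_right _ _
    rw [le_div_iff₀ (by positivity)] at h1
    linarith
  refine ⟨a * ρ₀ ^ 2, by positivity, ?_⟩
  intro φ u hφ hmod hconc hsol x₀ hx₀ r hr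
  obtain ⟨hfr, hx₀half⟩ := hx₀
  obtain ⟨hr0, hr1⟩ := hr
  rw [mem_ball_zero_iff] at hx₀half
  by_contra! hcon
  have hx₀r : Metric.closedBall x₀ r ⊆ Metric.ball 0 1 := by
    intro x hx
    rw [Metric.mem_closedBall, dist_eq_norm] at hx
    rw [mem_ball_zero_iff]
    have := norm_le_norm_add_norm_sub x₀ x
    linarith [norm_sub_rev x₀ x]
  -- Boundedness is needed because `sSup` of an unbounded set of reals takes the default value 0.
  have hbdd : BddAbove ((fun x => u x - φ x) '' Metric.ball x₀ r) := by
    have h1 : ContinuousOn (fun x => u x - φ x) (Metric.closedBall x₀ r) :=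
      (hsol.1.mono hx₀r).sub (hφ.continuousOn.mono hx₀r)
    exact ((isCompact_closedBall x₀ r).bddAbove_image h1).mono
      (image_mono Metric.ball_subset_closedBall)
  have hlt : ∀ x ∈ Metric.ball x₀ r, u x - φ x < a * (ρ₀ * r) ^ 2 := by
    intro x hx
    refine (le_csSup hbdd (mem_image_of_mem _ hx)).trans_lt (hcon.trans_eq (by ring))
  have hWo := isOpen_noncontactSet Metric.isOpen_ball hφ.continuousOn hsol.1
  have hx₀1 : x₀ ∈ Metric.ball (0 : Eucl n) 1 := hx₀r (Metric.mem_closedBall_self hr0.le)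
  rw [hWo.frontier_eq] at hfr
  obtain ⟨hcl, hnotin⟩ := hfr
  have hcontact : u x₀ = φ x₀ := by
    refine le_antisymm ?_ (hsol.2.1 x₀ hx₀1)
    by_contra! h
    exact hnotin ⟨hx₀1, h⟩
  set ρ : ℝ := ρ₀ * r with hρ
  have hρ0 : 0 < ρ := by positivity
  have hρr : ρ ≤ r / 4 := by
    calc ρ₀ * r ≤ 1 / 4 * r := by gcongr
      _ = r / 4 := by ring
  have hρρ₀ : ρ < ρ₀ := mul_lt_of_lt_one_right hρ₀0 (by linarith)
  obtain ⟨x₁, hx₁, hx₁d⟩ := Metric.mem_closure_iff.1 hcl ρ hρ0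
  have hx₁n : ‖x₁‖ < 1 / 2 + ρ := by
    have := norm_le_norm_add_norm_sub x₀ x₁
    rw [dist_eq_norm] at hx₁d
    linarith [norm_sub_rev x₀ x₁]
  have hballR : Metric.ball x₁ (2 * ρ) ⊆ Metric.ball 0 R := by
    intro x hx
    rw [Metric.mem_ball, dist_eq_norm] at hx
    rw [mem_ball_zero_iff]
    have := norm_le_norm_add_norm_sub x₁ x
    linarith [norm_sub_rev x₁ x]
  have hball1 : Metric.ball x₁ (2 * ρ) ⊆ Metric.ball 0 1 :=
    hballR.trans (Metric.ball_subset_ball hR1)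
  have hosc : ∀ x ∈ Metric.ball x₁ (2 * ρ), ∀ y ∈ Metric.ball x₁ (2 * ρ),
      ‖hessian φ x - hessian φ y‖ ≤ η := by
    intro x hx y hy
    refine (hmod x (hballR hx) y (hballR hy)).trans (hωt _ dist_nonneg ?_)
    rw [Metric.mem_ball] at hx hy
    have := dist_triangle_right x y x₁
    linarith
  -- The doubled ball serves both cases: it leaves room to move by ρ from points of B_ρ(x₁), and it
  -- contains B_ρ(x₀).
  by_cases hgrad : ∃ y ∈ Metric.ball x₁ (2 * ρ), ∇ φ y ≠ 0
  · have hf := hform _ φ x₁ ρ Metric.isOpen_ball hφ hconc hρ0 hball1 hosc hgrad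
    have hsub : Metric.ball x₁ ρ ⊆ Metric.ball x₁ (2 * ρ) := Metric.ball_subset_ball (by linarith)
    have hM : ∀ x ∈ Metric.ball x₁ ρ, ‖hessian φ x‖ ≤ ‖hessian φ x₁‖ + η := by
      intro x hx
      have h1 := hosc x (hsub hx) x₁ (Metric.mem_ball_self (by linarith))
      have h2 := norm_le_norm_add_norm_sub (hessian φ x₁) (hessian φ x)
      linarith [norm_sub_rev (hessian φ x₁) (hessian φ x)]
    have hψ := isWeaklyPSuperharmonic_add_quadratic hp ha0.le hc hε hρ0 hac haε
      Metric.isOpen_ball hφ (hsub.trans hball1) hM hf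
    obtain ⟨x, hx, hxa⟩ := exists_quadratic_le_of_superharmonic hn hp Metric.isOpen_ball hφ hsol
      hρ0 hx₁.2 ((Metric.closedBall_subset_ball (by linarith)).trans hball1) hψ
    refine absurd (hlt x ?_) hxa.not_gt
    rw [Metric.mem_closedBall] at hx
    rw [Metric.mem_ball]
    have := dist_triangle x x₁ x₀
    rw [dist_comm x₀] at hx₁d
    linarith
  · push Not at hgrad
    have hsub : Metric.ball x₀ ρ ⊆ Metric.ball x₁ (2 * ρ) :=
      Metric.ball_subset_ball' (by linarith)
    exact notMem_closure_noncontactSet_of_gradient_eq_zero hn hp hφ hsol hρ0 (hsub.trans hball1)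
      (fun x hx => hgrad x (hsub hx)) hcontact hcl
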